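/- Let $d\ge 1$ and let $\mathcal A$ be the set of all $a=(\alpha,\delta)\in\mathbb R^d\times\mathbb R^d$ with $2\sum_{i=1}^d\alpha_i=1$, $\delta_i\ge 0$ and $\alpha_i-\delta_i/2>0$ for all $i$. For $a\in\mathcal A$ let $(\mathbf S_t)_{t\ge0}=(\mathbf S_t(a))_{t\ge 0}$ be the random walk in $\mathbb Z^d$ with $\mathbf S_0=\mathbf 0$ and $\mathbf S_t=\mathbf S_{t-1}+\mathbf e_t$ such that, given the history up to time $t-1$, each of the vectors $\mathbf 1_i$ and $-\mathbf 1_i$ ($1\le i\le d$) is taken by $\mathbf e_t$ with probability $r_i(\mathbf S_{t-1})$, and $\mathbf e_t=\mathbf 0$ with the complementary probability. In Model 2, $r_i(\mathbf x)=\alpha_i$ if $x^{(i)}=0$ and $r_i(\mathbf x)=\alpha_i-\delta_i/2$ if $x^{(i)}\neq0$; put $k_i=\frac{2\alpha_i}{2\alpha_i-\delta_i}$. In Model 3, $r_i(\mathbf x)=\alpha_i-\delta_i/2$ if $x^{(i)}=0$ and $r_i(\mathbf x)=\alpha_i$ if $x^{(i)}\ne0$; put $k_i=\frac{2\alpha_i-\delta_i}{2\alpha_i}$.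 (For $\delta=0$ both are the symmetric random walk.) Let $\|\mathbf x\|=\sum_i|x^{(i)}|$, $t_0=0$, $t_{j+1}=\inf\{t>t_j:\|\mathbf S_t\|\ne\|\mathbf S_{t_j}\|\}$, and $$p^{(a,d)}(n)=\lim_{j\to\infty}\mathsf P\{\|\mathbf S_{t_{j+1}}\|=n+1\mid\|\mathbf S_{t_j}\|=n\},$$ the limit being taken along those $j$ (infinitely many) for which $\mathsf P\{\|\mathbf S_{t_j}\|=n\}>0$. For $\gamma>0$ and $n\ge1$, $BD(\gamma,d)$ denotes the birth-and-death process with $$\mu_n(\gamma,d)=\sum_{i=1}^d i\gamma^i\binom di\binom{n-1}{i-1},\qquad \lambda_n(\gamma,d)=\mu_n(\gamma,d)+\gamma\sum_{i=1}^{d-1}(d-i)\gamma^i\binom di\binom{n-1}{i-1},$$ and for $k>0$ let $$p_n(d,k,\dots,k)=\frac{2k\sum_{i=1}^{d-1}(d-i)(2k)^i\binom di\binom{n-1}{i-1}+\sum_{i=1}^d i(2k)^i\binom di\binom{n-1}{i-1}}{2k\sum_{i=1}^{d-1}(d-i)(2k)^i\binom di\binom{n-1}{i-1}+2\sum_{i=1}^d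 i(2k)^i\binom di\binom{n-1}{i-1}}.$$ **Theorem 2.** For each of the Models 2 and 3: (1) The limits $p^{(a,d)}(n)$ exist for all $a\in\mathcal A$ and $n\ge0$, and the family is semiconservative: there is $a^*\in\mathcal A$ such that either $p^{(a^*,d)}(n)\le p^{(a,d)}(n)$ for all $a\in\mathcal A$, $n\ge0$, or $p^{(a^*,d)}(n)\ge p^{(a,d)}(n)$ for all $a\in\mathcal A$, $n\ge0$. (2) For all $a\in\mathcal A$ and $n\ge1$, with $\underline k=\min_i k_i$ and $\overline k=\max_i k_i$, $$\frac{\lambda_n(2\underline k,d)}{\lambda_n(2\underline k,d)+\mu_n(2\underline k,d)}\ \le\ p^{(a,d)}(n)\ \le\ \frac{\lambda_n(2\overline k,d)}{\lambda_n(2\overline k,d)+\mu_n(2\overline k,d)}.$$ If $k_1=\dots=k_d=k$, then $p^{(a,d)}(n)=p_n(d,k,\dots,k)$. (3) If $d\ge2$ and $n\ge1$, then $k\mapsto p_n(d,k,\dots,k)$ is strictly increasing on $(0,\infty)$. -/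

import Mathlib

open MeasureTheory ProbabilityTheory Filter Topology

noncomputable section

namespace SemiWalk

/-- The parameter set `𝒜` shared by Models 2 and 3: vectors `α`, `δ` with `2 ∑ αᵢ = 1`,
`δᵢ ≥ 0` and `αᵢ - δᵢ/2 > 0`. The value `δ = 0` gives the symmetric random walks (Model 1). -/
structure Params (d : ℕ) where
  α : Fin d → ℝ
  δ : Fin d → ℝ
  sum_α : 2 * ∑ i, α i = 1
  δ_nonneg : ∀ i, 0 ≤ δ i
  half_δ_lt : ∀ i, 0 < α i - δ i / 2

/-- Model 2: the probability of each of the two steps `±1ᵢ` from state `x`. -/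
def rate2 {d : ℕ} (a : Params d) (x : Fin d → ℤ) (i : Fin d) : ℝ :=
  if x i = 0 then a.α i else a.α i - a.δ i / 2

/-- Model 3: the probability of each of the two steps `±1ᵢ` from state `x`. -/
def rate3 {d : ℕ} (a : Params d) (x : Fin d → ℤ) (i : Fin d) : ℝ :=
  if x i = 0 then a.α i - a.δ i / 2 else a.α i

/-- Model 2: `kᵢ = 2αᵢ / (2αᵢ - δᵢ)`. -/
def k2 {d : ℕ} (a : Params d) (i : Fin d) : ℝ := 2 * a.α i / (2 * a.α i - a.δ i)

/-- Model 3: `kᵢ = (2αᵢ - δᵢ) / (2αᵢ)`. -/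
def k3 {d : ℕ} (a : Params d) (i : Fin d) : ℝ := (2 * a.α i - a.δ i) / (2 * a.α i)

/-- The event that the path up to time `t` is `x 0, …, x t`. -/
def history {Ω : Type*} {d : ℕ} (S : ℕ → Ω → Fin d → ℤ) (x : ℕ → Fin d → ℤ) (t : ℕ) : Set Ω :=
  {ω | ∀ s ≤ t, S s ω = x s}

/-- `S` is a random walk in `ℤ^d` started at the origin: `S_{t+1} = S_t + e_{t+1}`, where, given
the history up to time `t`, the step `e_{t+1}` is `1ᵢ` or `-1ᵢ` with probability `rate S_t i` each,
and `0` with the complementary probability. -/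
structure IsWalk {Ω : Type*} [MeasurableSpace Ω] {d : ℕ} (rate : (Fin d → ℤ) → Fin d → ℝ)
    (P : Measure Ω) (S : ℕ → Ω → Fin d → ℤ) : Prop where
  measurable : ∀ t, Measurable (S t)
  start : ∀ᵐ ω ∂P, S 0 ω = 0
  step_pos : ∀ (t : ℕ) (x : ℕ → Fin d → ℤ) (i : Fin d),
    P.real (history S x t ∩ {ω | S (t + 1) ω = x t + Pi.single i 1}) =
      P.real (history S x t) * rate (x t) i
  step_neg : ∀ (t : ℕ) (x : ℕ → Fin d → ℤ) (i : Fin d),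
    P.real (history S x t ∩ {ω | S (t + 1) ω = x t - Pi.single i 1}) =
      P.real (history S x t) * rate (x t) i
  step_zero : ∀ (t : ℕ) (x : ℕ → Fin d → ℤ),
    P.real (history S x t ∩ {ω | S (t + 1) ω = x t}) =
      P.real (history S x t) * (1 - 2 * ∑ i, rate (x t) i)

/-- The norm `‖x‖ = ∑ |xᵢ|`. -/
def l1 {d : ℕ} (x : Fin d → ℤ) : ℕ := ∑ i, (x i).natAbs

/-- The active time instants of a path: `t₀ = 0` and
`t_{j+1} = inf {t > t_j : ‖x_t‖ ≠ ‖x_{t_j}‖}`. For a path started at the origin,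
`t₁ = inf {t > 0 : ‖x_t‖ > 0}`. -/
def activeTime {d : ℕ} (x : ℕ → Fin d → ℤ) : ℕ → ℕ
  | 0 => 0
  | j + 1 => sInf {t | activeTime x j < t ∧ l1 (x t) ≠ l1 (x (activeTime x j))}

/-- `‖S_{t_j}‖`. -/
def activeNorm {Ω : Type*} {d : ℕ} (S : ℕ → Ω → Fin d → ℤ) (j : ℕ) (ω : Ω) : ℕ :=
  l1 (S (activeTime (fun t => S t ω) j) ω)

/-- The conditional probability `P{‖S_{t_{j+1}}‖ = n + 1 | ‖S_{t_j}‖ = n}`. -/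
def upProb {Ω : Type*} [MeasurableSpace Ω] {d : ℕ} (P : Measure Ω) (S : ℕ → Ω → Fin d → ℤ)
    (n j : ℕ) : ℝ :=
  (cond P {ω | activeNorm S j ω = n}).real {ω | activeNorm S (j + 1) ω = n + 1}

/-- `p` is the limiting up-probability at level `n`: the limit as `j → ∞` of
`P{‖S_{t_{j+1}}‖ = n + 1 | ‖S_{t_j}‖ = n}`. Since `‖S_{t_j}‖` has the parity of `j`, the condition
has probability zero for every other `j`; the limit runs over the `j` for which the conditional
probability is defined, and there have to be infinitely many of those. -/
def HasLimitingUpProb {Ω : Type*} [MeasurableSpace Ω] {d : ℕ} (P : Measure Ω)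
    (S : ℕ → Ω → Fin d → ℤ) (n : ℕ) (p : ℝ) : Prop :=
  (∃ᶠ j in atTop, P {ω | activeNorm S j ω = n} ≠ 0) ∧
    Tendsto (upProb P S n) (atTop ⊓ 𝓟 {j | P {ω | activeNorm S j ω = n} ≠ 0}) (𝓝 p)

/-- A family of random walks `S a`, `a ∈ A`, is semiconservative: all limiting up-probabilities
`p a n` exist, and there is a member `a₀` of the family whose limiting up-probabilities are
minimal at all levels, or maximal at all levels. -/
def IsSemiconservative {A : Type*} {Ω : A → Type*} [∀ a, MeasurableSpace (Ω a)] {d : ℕ}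
    (P : ∀ a, Measure (Ω a)) (S : ∀ a, ℕ → Ω a → Fin d → ℤ) : Prop :=
  ∃ p : A → ℕ → ℝ, (∀ a n, HasLimitingUpProb (P a) (S a) n (p a n)) ∧
    ∃ a₀ : A, (∀ a n, p a₀ n ≤ p a n) ∨ (∀ a n, p a n ≤ p a₀ n)

/-- The death rates of `BD(γ, d)` (for `n ≥ 1`). -/
def bdDeath (γ : ℝ) (d n : ℕ) : ℝ :=
  ∑ i ∈ Finset.Icc 1 d, (i : ℝ) * γ ^ i * d.choose i * (n - 1).choose (i - 1)

/-- The birth rates of `BD(γ, d)` (for `n ≥ 1`). -/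
def bdBirth (γ : ℝ) (d n : ℕ) : ℝ :=
  ∑ i ∈ Finset.Icc 1 d, (i : ℝ) * γ ^ i * d.choose i * (n - 1).choose (i - 1) +
    γ * ∑ i ∈ Finset.Icc 1 (d - 1),
      ((d : ℝ) - i) * γ ^ i * d.choose i * (n - 1).choose (i - 1)

/-- The up-probabilities of `BD(γ, d)` (for `n ≥ 1`). -/
def bdUp (γ : ℝ) (d n : ℕ) : ℝ := bdBirth γ d n / (bdBirth γ d n + bdDeath γ d n)

/-- The explicit expression `p_n(d, k, …, k)` (for `n ≥ 1`). -/
def pEqual (d n : ℕ) (k : ℝ) : ℝ :=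
  (2 * k * ∑ i ∈ Finset.Icc 1 (d - 1),
        ((d : ℝ) - i) * (2 * k) ^ i * d.choose i * (n - 1).choose (i - 1) +
      ∑ i ∈ Finset.Icc 1 d, (i : ℝ) * (2 * k) ^ i * d.choose i * (n - 1).choose (i - 1)) /
    (2 * k * ∑ i ∈ Finset.Icc 1 (d - 1),
        ((d : ℝ) - i) * (2 * k) ^ i * d.choose i * (n - 1).choose (i - 1) +
      2 * ∑ i ∈ Finset.Icc 1 d, (i : ℝ) * (2 * k) ^ i * d.choose i * (n - 1).choose (i - 1))

/-- For a family of walks with the quantities `k a i` (`i = 1, …, d`): at every level `n ≥ 1` the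
limiting up-probability of the walk with parameter `a` exists and lies between the
up-probabilities of `BD(2 minᵢ kᵢ, d)` and `BD(2 maxᵢ kᵢ, d)`; if all `kᵢ` are equal to `κ`, it is
`p_n(d, κ, …, κ)`. -/
def BoundedByBD {d : ℕ} {A : Type*} {Ω : A → Type*} [∀ a, MeasurableSpace (Ω a)]
    (k : A → Fin d → ℝ) (P : ∀ a, Measure (Ω a)) (S : ∀ a, ℕ → Ω a → Fin d → ℤ) : Prop :=
  ∀ (a : A) (n : ℕ), 1 ≤ n → ∃ p : ℝ, HasLimitingUpProb (P a) (S a) n p ∧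
    bdUp (2 * ⨅ i, k a i) d n ≤ p ∧ p ≤ bdUp (2 * ⨆ i, k a i) d n ∧
    ∀ κ : ℝ, (∀ i, k a i = κ) → p = pEqual d n κ

end SemiWalk

end

noncomputable section

namespace SemiWalk

/-! Both models are instances of one walk, with `k i ≥ 1` in Model 2 and `k i ≤ 1` in Model 3. The
walk is reversible for the product measure `weight`. Every nonzero step changes the norm by exactly
one, so the norm at active times is the norm of the jump chain, whose law has density `heat` with
respect to the reversible measure `weight * exitRate`.

The limits exist because, conditioned on norm `n`, the jump chain approaches its reversible measure
restricted to the sphere. This is the ratio limit theorem `tendsto_heat_add_div`. The return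
densities at even times are log-convex by Cauchy–Schwarz and decay at most polynomially, so their
successive ratios tend to 1. A second use of Cauchy–Schwarz (`tendsto_heat_diff`) shows that the
normalised kernel is asymptotically harmonic. Every limit point is thus a nonnegative harmonic
function equal to 1 at the origin, and the only such function is constant
(`eq_one_of_mem_harmonics`): the generators of the coordinates commute, so an extreme harmonic
function is an eigenfunction of each of them, and a nonnegative concave function on `ℤ` is constant.

The limit is then a finite quotient (`IsWalk.hasLimitingUpProb`). Grouping the points of a sphere by
support turns it into subset sums of `∏ k i` with coefficients `levelCount n m`. These coefficients
are log-concave in `m`, so the ratio of neighbouring subset sums increases in every `k i`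
(`subsetSum_ratio_mono`). Replacing all `k i` by their minimum or maximum gives the bounds,
replacing them by 1 gives semiconservativity with the symmetric walk as extreme member, and
strictness at `m = 0, 1, 2` gives strict monotonicity. -/

/-- The common form of the rates of both models: `β i` on the hyperplane `x i = 0` and
`β i / k i` off it. -/
def rate {d : ℕ} (β k : Fin d → ℝ) (x : Fin d → ℤ) (i : Fin d) : ℝ :=
  if x i = 0 then β i else β i / k i

/-- The reversible measure of the walk. -/
def weight {d : ℕ} (k : Fin d → ℝ) (x : Fin d → ℤ) : ℝ := ∏ i, if x i = 0 then 1 else k i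

/-- The probability of leaving `x` in one step. -/
def exitRate {d : ℕ} (β k : Fin d → ℝ) (x : Fin d → ℤ) : ℝ := 2 * ∑ i, rate β k x i

/-- The Markov operator of the jump chain. -/
def jumpAvg {d : ℕ} (β k : Fin d → ℝ) (f : (Fin d → ℤ) → ℝ) (x : Fin d → ℤ) : ℝ :=
  (∑ i, rate β k x i * (f (x + Pi.single i 1) + f (x - Pi.single i 1))) / exitRate β k x

/-- The inner product for the reversible measure of the jump chain. -/
def pairing {d : ℕ} (β k : Fin d → ℝ) (f g : (Fin d → ℤ) → ℝ) : ℝ :=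
  ∑' x, weight k x * exitRate β k x * (f x * g x)

/-- The density of the jump chain started at `z`, with respect to its reversible measure. -/
def heat {d : ℕ} (β k : Fin d → ℝ) (z : Fin d → ℤ) (j : ℕ) : (Fin d → ℤ) → ℝ :=
  (jumpAvg β k)^[j] (Pi.single z (weight k z * exitRate β k z)⁻¹)

/-! ### Reversibility and the operator of the jump chain. -/

section Rates

variable {d : ℕ} {β k : Fin d → ℝ}

lemma rate_pos (hβ : ∀ i, 0 < β i) (hk : ∀ i, 0 < k i) (x : Fin d → ℤ) (i : Fin d) :
    0 < rate β k x i := by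
  unfold rate; split_ifs
  · exact hβ i
  · exact div_pos (hβ i) (hk i)

lemma weight_pos (hk : ∀ i, 0 < k i) (x : Fin d → ℤ) : 0 < weight k x :=
  Finset.prod_pos fun i _ => by split_ifs; exacts [one_pos, hk i]

lemma exitRate_pos [NeZero d] (hβ : ∀ i, 0 < β i) (hk : ∀ i, 0 < k i) (x : Fin d → ℤ) :
    0 < exitRate β k x :=
  mul_pos two_pos (Finset.sum_pos (fun i _ => rate_pos hβ hk x i) ⟨0, Finset.mem_univ _⟩)

/-- Off the hyperplane the factor `k i` of the weight cancels the denominator of the rate, so the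
product does not involve `x i`. This is detailed balance: an edge in direction `i` has the same
conductance at both ends. -/
lemma weight_mul_rate (hk : ∀ i, 0 < k i) (x : Fin d → ℤ) (i : Fin d) :
    weight k x * rate β k x i =
      β i * ∏ l ∈ Finset.univ.erase i, if x l = 0 then 1 else k l := by
  have := (hk i).ne'
  rw [weight, rate, ← Finset.mul_prod_erase Finset.univ _ (Finset.mem_univ i)]
  split_ifs
  · ring
  · field_simp

lemma weight_mul_rate_congr (hk : ∀ i, 0 < k i) {x y : Fin d → ℤ} {i : Fin d}
    (h : ∀ l, l ≠ i → x l = y l) :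
    weight k x * rate β k x i = weight k y * rate β k y i := by
  rw [weight_mul_rate hk, weight_mul_rate hk]
  congr 1
  exact Finset.prod_congr rfl fun l hl => by rw [h l (Finset.ne_of_mem_erase hl)]

lemma weight_mul_rate_add (hk : ∀ i, 0 < k i) (x : Fin d → ℤ) (i : Fin d) (v : ℤ) :
    weight k (x + Pi.single i v) * rate β k (x + Pi.single i v) i =
      weight k x * rate β k x i :=
  weight_mul_rate_congr hk fun l hl => by simp [hl]

lemma weight_mul_rate_sub (hk : ∀ i, 0 < k i) (x : Fin d → ℤ) (i : Fin d) (v : ℤ) :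
    weight k (x - Pi.single i v) * rate β k (x - Pi.single i v) i =
      weight k x * rate β k x i :=
  weight_mul_rate_congr hk fun l hl => by simp [hl]

lemma rate_le (hβ : ∀ i, 0 < β i) (hk : ∀ i, 0 < k i) (x : Fin d → ℤ) (i : Fin d) :
    rate β k x i ≤ β i + β i / k i := by
  have := (hβ i).le
  have := (div_pos (hβ i) (hk i)).le
  unfold rate; split_ifs <;> linarith

lemma jumpAvg_smul (c : ℝ) (f : (Fin d → ℤ) → ℝ) :
    jumpAvg β k (fun x => c * f x) = fun x => c * jumpAvg β k f x := by
  funext x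
  simp only [jumpAvg]
  rw [← mul_div_assoc, Finset.mul_sum]
  congr 1
  exact Finset.sum_congr rfl fun i _ => by ring

lemma iterate_jumpAvg_smul (j : ℕ) (c : ℝ) (f : (Fin d → ℤ) → ℝ) :
    (jumpAvg β k)^[j] (fun x => c * f x) = fun x => c * (jumpAvg β k)^[j] f x := by
  induction j generalizing f with
  | zero => rfl
  | succ j ih => rw [Function.iterate_succ_apply, jumpAvg_smul, ih]; rfl

lemma finite_support_jumpAvg {f : (Fin d → ℤ) → ℝ} (hf : f.support.Finite) :
    (jumpAvg β k f).support.Finite := by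
  have h : (⋃ i : Fin d, ((fun x => x + (Pi.single i 1 : Fin d → ℤ)) ⁻¹' f.support ∪
      (fun x => x - (Pi.single i 1 : Fin d → ℤ)) ⁻¹' f.support)).Finite :=
    Set.finite_iUnion fun i =>
      (hf.preimage (add_left_injective _).injOn).union
        (hf.preimage sub_left_injective.injOn)
  refine h.subset fun x hx => ?_
  contrapose! hx
  simp only [Set.mem_iUnion, Set.mem_union, Set.mem_preimage, Function.mem_support, not_exists,
    not_or, not_not] at hx
  simp [jumpAvg, hx]

lemma finite_support_iterate_jumpAvg {f : (Fin d → ℤ) → ℝ} (hf : f.support.Finite) (j : ℕ) :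
    ((jumpAvg β k)^[j] f).support.Finite := by
  induction j with
  | zero => exact hf
  | succ j ih => rw [Function.iterate_succ_apply']; exact finite_support_jumpAvg ih

lemma summable_pairing {f g : (Fin d → ℤ) → ℝ} (hf : f.support.Finite) :
    Summable fun x => weight k x * exitRate β k x * (f x * g x) :=
  summable_of_hasFiniteSupport <| hf.subset fun x hx => by
    contrapose! hx; simp_all

lemma pairing_comm (f g : (Fin d → ℤ) → ℝ) : pairing β k f g = pairing β k g f := by
  simp only [pairing, mul_comm (f _)]

lemma pairing_sub_self {f g : (Fin d → ℤ) → ℝ} (hf : f.support.Finite) (hg : g.support.Finite) :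
    pairing β k (f - g) (f - g) =
      pairing β k f f - 2 * pairing β k f g + pairing β k g g := by
  have s1 := summable_pairing (β := β) (k := k) (g := f) hf
  have s2 := summable_pairing (β := β) (k := k) (g := g) hf
  have s3 := summable_pairing (β := β) (k := k) (g := g) hg
  simp only [pairing]
  rw [← tsum_mul_left, ← s1.tsum_sub (s2.mul_left 2),
    ← (s1.sub (s2.mul_left 2)).tsum_add s3]
  exact tsum_congr fun x => by simp only [Pi.sub_apply]; ring

lemma pairing_sub_left {f g : (Fin d → ℤ) → ℝ} (hf : f.support.Finite) (hg : g.support.Finite)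
    (h : (Fin d → ℤ) → ℝ) :
    pairing β k (f - g) h = pairing β k f h - pairing β k g h := by
  simp only [pairing]
  rw [← (summable_pairing hf).tsum_sub (summable_pairing hg)]
  exact tsum_congr fun x => by simp only [Pi.sub_apply]; ring

lemma finite_support_single (z : Fin d → ℤ) (c : ℝ) :
    (Pi.single z c : (Fin d → ℤ) → ℝ).support.Finite :=
  (Set.finite_singleton z).subset Pi.support_single_subset

lemma finite_support_heat (z : Fin d → ℤ) (j : ℕ) : (heat β k z j).support.Finite :=
  finite_support_iterate_jumpAvg (finite_support_single _ _) j

lemma heat_succ (z : Fin d → ℤ) (j : ℕ) :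
    heat β k z (j + 1) = jumpAvg β k (heat β k z j) :=
  Function.iterate_succ_apply' _ _ _

end Rates

section Operator

variable {d : ℕ} [NeZero d] {β k : Fin d → ℝ}

lemma exitRate_mul_jumpAvg (hβ : ∀ i, 0 < β i) (hk : ∀ i, 0 < k i) (f : (Fin d → ℤ) → ℝ)
    (x : Fin d → ℤ) : exitRate β k x * jumpAvg β k f x =
      ∑ i, rate β k x i * (f (x + Pi.single i 1) + f (x - Pi.single i 1)) :=
  mul_div_cancel₀ _ (exitRate_pos hβ hk x).ne'

lemma jumpAvg_mono (hβ : ∀ i, 0 < β i) (hk : ∀ i, 0 < k i) {f g : (Fin d → ℤ) → ℝ}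
    (h : ∀ x, f x ≤ g x) (x : Fin d → ℤ) : jumpAvg β k f x ≤ jumpAvg β k g x := by
  unfold jumpAvg
  have := exitRate_pos hβ hk x
  gcongr with i
  · exact (rate_pos hβ hk x i).le
  · exact h _
  · exact h _

lemma jumpAvg_const (hβ : ∀ i, 0 < β i) (hk : ∀ i, 0 < k i) (c : ℝ) :
    jumpAvg β k (fun _ => c) = fun _ => c := by
  funext x
  rw [jumpAvg, div_eq_iff (exitRate_pos hβ hk x).ne', exitRate, ← Finset.sum_mul]
  ring

lemma iterate_jumpAvg_mono (hβ : ∀ i, 0 < β i) (hk : ∀ i, 0 < k i) (j : ℕ)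
    {f g : (Fin d → ℤ) → ℝ} (h : ∀ x, f x ≤ g x) (x : Fin d → ℤ) :
    (jumpAvg β k)^[j] f x ≤ (jumpAvg β k)^[j] g x := by
  induction j generalizing f g with
  | zero => exact h x
  | succ j ih => exact ih (jumpAvg_mono hβ hk h)

lemma iterate_jumpAvg_const (hβ : ∀ i, 0 < β i) (hk : ∀ i, 0 < k i) (j : ℕ) (c : ℝ) :
    (jumpAvg β k)^[j] (fun _ => c) = fun _ => c :=
  Function.iterate_fixed (jumpAvg_const hβ hk c) j

/-- Self-adjointness: shift the summation variable by a unit vector and use that conductances are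
symmetric. The finite support of `f` makes every rearrangement legitimate. -/
lemma pairing_jumpAvg (hβ : ∀ i, 0 < β i) (hk : ∀ i, 0 < k i) {f : (Fin d → ℤ) → ℝ}
    (hf : f.support.Finite) (g : (Fin d → ℤ) → ℝ) :
    pairing β k (jumpAvg β k f) g = pairing β k f (jumpAvg β k g) := by
  have fin1 : ∀ (i : Fin d) (v : Fin d → ℤ) (F : (Fin d → ℤ) → ℝ),
      Summable fun x => weight k x * rate β k x i * (f (x + v) * F x) := fun i v F =>
    summable_of_hasFiniteSupport <| (hf.preimage (add_left_injective v).injOn).subset fun x hx => by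
      contrapose! hx; simp_all
  have fin2 : ∀ (i : Fin d) (F : (Fin d → ℤ) → ℝ),
      Summable fun x => weight k x * rate β k x i * (f x * F x) := fun i F => by
    simpa using fin1 i 0 F
  have lhs : pairing β k (jumpAvg β k f) g =
      ∑ i, (∑' x, weight k x * rate β k x i * (f (x + Pi.single i 1) * g x) +
        ∑' x, weight k x * rate β k x i * (f (x + -Pi.single i 1) * g x)) := by
    simp_rw [← (fin1 _ _ _).tsum_add (fin1 _ _ _)]
    rw [← Summable.tsum_finsetSum fun i _ => (fin1 _ _ _).add (fin1 _ _ _)]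
    refine tsum_congr fun x => ?_
    rw [show weight k x * exitRate β k x * (jumpAvg β k f x * g x) =
      weight k x * (exitRate β k x * jumpAvg β k f x) * g x by ring, exitRate_mul_jumpAvg hβ hk,
      Finset.mul_sum, Finset.sum_mul]
    exact Finset.sum_congr rfl fun i _ => by simp only [sub_eq_add_neg]; ring
  have rhs : pairing β k f (jumpAvg β k g) =
      ∑ i, (∑' x, weight k x * rate β k x i * (f x * g (x - Pi.single i 1)) +
        ∑' x, weight k x * rate β k x i * (f x * g (x + Pi.single i 1))) := by
    simp_rw [← (fin2 _ _).tsum_add (fin2 _ _)]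
    rw [← Summable.tsum_finsetSum fun i _ => (fin2 _ _).add (fin2 _ _)]
    refine tsum_congr fun x => ?_
    rw [show weight k x * exitRate β k x * (f x * jumpAvg β k g x) =
      weight k x * (exitRate β k x * jumpAvg β k g x) * f x by ring, exitRate_mul_jumpAvg hβ hk,
      Finset.mul_sum, Finset.sum_mul]
    exact Finset.sum_congr rfl fun i _ => by ring
  rw [lhs, rhs]
  refine Finset.sum_congr rfl fun i _ => ?_
  congr 1
  · rw [← (Equiv.subRight (Pi.single i (1 : ℤ))).tsum_eq]
    simp only [Equiv.subRight_apply, sub_add_cancel, weight_mul_rate_sub hk]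
  · rw [← (Equiv.addRight (Pi.single i (1 : ℤ))).tsum_eq]
    simp only [Equiv.coe_addRight, add_neg_cancel_right, weight_mul_rate_add hk]

lemma pairing_iterate_jumpAvg (hβ : ∀ i, 0 < β i) (hk : ∀ i, 0 < k i) (j : ℕ)
    {f : (Fin d → ℤ) → ℝ} (hf : f.support.Finite) (g : (Fin d → ℤ) → ℝ) :
    pairing β k ((jumpAvg β k)^[j] f) g = pairing β k f ((jumpAvg β k)^[j] g) := by
  induction j generalizing f with
  | zero => rfl
  | succ j ih =>
    rw [Function.iterate_succ_apply, ih (finite_support_jumpAvg hf), pairing_jumpAvg hβ hk hf,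
      Function.iterate_succ_apply']

lemma weight_mul_exitRate_pos (hβ : ∀ i, 0 < β i) (hk : ∀ i, 0 < k i) (x : Fin d → ℤ) :
    0 < weight k x * exitRate β k x := mul_pos (weight_pos hk x) (exitRate_pos hβ hk x)

lemma sq_pairing_le (hβ : ∀ i, 0 < β i) (hk : ∀ i, 0 < k i) {f g : (Fin d → ℤ) → ℝ}
    (hf : f.support.Finite) (hg : g.support.Finite) :
    pairing β k f g ^ 2 ≤ pairing β k f f * pairing β k g g := by
  have key : ∀ F G : (Fin d → ℤ) → ℝ, (∀ x, x ∉ (hf.union hg).toFinset → F x = 0) →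
      pairing β k F G = ∑ x ∈ (hf.union hg).toFinset,
        weight k x * exitRate β k x * (F x * G x) := fun F G hF =>
    tsum_eq_sum fun x hx => by simp [hF x hx]
  have h1 : ∀ x, x ∉ (hf.union hg).toFinset → f x = 0 := fun x hx => by simp_all
  have h2 : ∀ x, x ∉ (hf.union hg).toFinset → g x = 0 := fun x hx => by simp_all
  rw [key f g h1, key f f h1, key g g h2]
  refine Finset.sum_sq_le_sum_mul_sum_of_sq_le_mul _ (fun x _ => ?_) (fun x _ => ?_) fun x _ => ?_
  · exact mul_nonneg (weight_mul_exitRate_pos hβ hk x).le (mul_self_nonneg _)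
  · exact mul_nonneg (weight_mul_exitRate_pos hβ hk x).le (mul_self_nonneg _)
  · exact le_of_eq (by ring)

lemma pairing_single (hβ : ∀ i, 0 < β i) (hk : ∀ i, 0 < k i) (z : Fin d → ℤ)
    (g : (Fin d → ℤ) → ℝ) :
    pairing β k (Pi.single z (weight k z * exitRate β k z)⁻¹) g = g z := by
  rw [pairing, tsum_eq_single z fun x hx => by simp [Pi.single_eq_of_ne hx]]
  rw [Pi.single_eq_same, ← mul_assoc, mul_inv_cancel₀ (weight_mul_exitRate_pos hβ hk z).ne',
    one_mul]

lemma pairing_heat_left (hβ : ∀ i, 0 < β i) (hk : ∀ i, 0 < k i) (z : Fin d → ℤ) (j : ℕ)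
    (g : (Fin d → ℤ) → ℝ) : pairing β k (heat β k z j) g = (jumpAvg β k)^[j] g z := by
  rw [heat, pairing_iterate_jumpAvg hβ hk _ (finite_support_single _ _), pairing_single hβ hk]

/-- Chapman–Kolmogorov in symmetric form. It makes kernel values into inner products, so that
Cauchy–Schwarz applies to them. -/
lemma pairing_heat (hβ : ∀ i, 0 < β i) (hk : ∀ i, 0 < k i) (z w : Fin d → ℤ) (i j : ℕ) :
    pairing β k (heat β k z i) (heat β k w j) = heat β k w (i + j) z := by
  rw [pairing_heat_left hβ hk, heat, ← Function.iterate_add_apply]; rfl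

lemma heat_comm (hβ : ∀ i, 0 < β i) (hk : ∀ i, 0 < k i) (z w : Fin d → ℤ) (j : ℕ) :
    heat β k z j w = heat β k w j z := by
  rw [← zero_add j, ← pairing_heat hβ hk, pairing_comm, pairing_heat hβ hk, add_comm]

lemma heat_nonneg (hβ : ∀ i, 0 < β i) (hk : ∀ i, 0 < k i) (z : Fin d → ℤ) (j : ℕ)
    (x : Fin d → ℤ) : 0 ≤ heat β k z j x := by
  have := iterate_jumpAvg_mono hβ hk j (f := fun _ => 0)
    (g := Pi.single z (weight k z * exitRate β k z)⁻¹) (fun x => ?_) x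
  · rwa [iterate_jumpAvg_const hβ hk] at this
  · by_cases h : x = z
    · subst h; simpa using (inv_pos.2 (weight_mul_exitRate_pos hβ hk x)).le
    · simp [h]

lemma heat_le (hβ : ∀ i, 0 < β i) (hk : ∀ i, 0 < k i) (z : Fin d → ℤ) (j : ℕ)
    (x : Fin d → ℤ) : heat β k z j x ≤ (weight k z * exitRate β k z)⁻¹ := by
  have := iterate_jumpAvg_mono hβ hk j (f := Pi.single z (weight k z * exitRate β k z)⁻¹)
    (g := fun _ => (weight k z * exitRate β k z)⁻¹) (fun x => ?_) x
  · rwa [iterate_jumpAvg_const hβ hk] at this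
  · by_cases h : x = z
    · subst h; simp
    · rw [Pi.single_eq_of_ne h]; exact (inv_pos.2 (weight_mul_exitRate_pos hβ hk z)).le

lemma pairing_heat_one (hβ : ∀ i, 0 < β i) (hk : ∀ i, 0 < k i) (z : Fin d → ℤ) (j : ℕ) :
    pairing β k (heat β k z j) (fun _ => 1) = 1 := by
  rw [pairing_heat_left hβ hk, iterate_jumpAvg_const hβ hk]

/-- If the chain can go from `z` to `x`, the kernel from `x` is dominated by that from `z`. -/
lemma exists_heat_le (hβ : ∀ i, 0 < β i) (hk : ∀ i, 0 < k i) {z x : Fin d → ℤ} {l : ℕ}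
    (h : 0 < heat β k z l x) :
    ∃ C, 0 < C ∧ ∀ j y, heat β k x j y ≤ C * heat β k z (j + l) y := by
  have hw := weight_mul_exitRate_pos hβ hk x
  refine ⟨(weight k x * exitRate β k x)⁻¹ / heat β k z l x, by positivity, fun j y => ?_⟩
  -- The normalised point mass at `x` lies below a multiple of the kernel from `z` after `l` jumps;
  -- the positive operator preserves this.
  have := iterate_jumpAvg_mono hβ hk j (f := Pi.single x (weight k x * exitRate β k x)⁻¹)
    (g := fun y => (weight k x * exitRate β k x)⁻¹ / heat β k z l x * heat β k z l y)
    (fun w => ?_) y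
  · rw [iterate_jumpAvg_smul] at this
    rwa [show heat β k z (j + l) = _ from Function.iterate_add_apply _ _ _ _]
  · by_cases hwx : w = x
    · subst hwx; rw [Pi.single_eq_same, div_mul_cancel₀ _ h.ne']
    · rw [Pi.single_eq_of_ne hwx]
      have := heat_nonneg hβ hk z l w
      positivity

end Operator

/-! ### Log-convex sequences. -/

/-- A bounded positive log-convex sequence is nonincreasing. -/
lemma antitone_of_sq_le {a : ℕ → ℝ} {M : ℝ} (pos : ∀ j, 0 < a j) (hM : ∀ j, a j ≤ M)
    (h : ∀ j, a (j + 1) ^ 2 ≤ a j * a (j + 2)) : Antitone a := by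
  have mono : Monotone fun j => a (j + 1) / a j := monotone_nat_of_le_succ fun j => by
    rw [div_le_div_iff₀ (pos _) (pos _)]
    nlinarith [h j]
  refine antitone_nat_of_succ_le fun j => ?_
  by_contra! hlt
  -- The ratios are nondecreasing, so a single ratio above 1 forces geometric growth, against the
  -- bound `M`.
  have hr : 1 < a (j + 1) / a j := (one_lt_div (pos j)).2 hlt
  have grow : ∀ i, (a (j + 1) / a j) ^ i * a j ≤ a (j + i) := fun i => by
    induction i with
    | zero => simp
    | succ i ih =>
      have := mono (Nat.le_add_right j i)
      simp only at this
      rw [le_div_iff₀ (pos _)] at this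
      calc _ = (a (j + 1) / a j) * ((a (j + 1) / a j) ^ i * a j) := by ring
        _ ≤ (a (j + 1) / a j) * a (j + i) := by gcongr
        _ ≤ _ := this
  obtain ⟨i, hi⟩ := pow_unbounded_of_one_lt (M / a j) hr
  rw [div_lt_iff₀ (pos j)] at hi
  linarith [grow i, hM (j + i)]

/-- The ratios of a bounded log-convex sequence without exponential decay tend to `1`. -/
lemma tendsto_ratio_of_sq_le {a : ℕ → ℝ} {M c : ℝ} {D : ℕ} (pos : ∀ j, 0 < a j)
    (hM : ∀ j, a j ≤ M) (h : ∀ j, a (j + 1) ^ 2 ≤ a j * a (j + 2)) (hc : 0 < c)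
    (low : ∀ j, c ≤ a j * (2 * j + 1) ^ D) :
    Tendsto (fun j => a (j + 1) / a j) atTop (𝓝 1) := by
  have mono : Monotone fun j => a (j + 1) / a j := monotone_nat_of_le_succ fun j => by
    rw [div_le_div_iff₀ (pos _) (pos _)]
    nlinarith [h j]
  have le1 : ∀ j, a (j + 1) / a j ≤ 1 := fun j =>
    (div_le_one (pos j)).2 (antitone_of_sq_le pos hM h (Nat.le_succ j))
  refine tendsto_order.2 ⟨fun r hr => ?_, fun r hr => Eventually.of_forall fun j =>
    (le1 j).trans_lt hr⟩
  -- The ratios increase, so if they are not eventually above `r` they never exceed `r < 1`; then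
  -- `a` decays geometrically, against the polynomial lower bound.
  by_contra hcon
  have small : ∀ j, a (j + 1) / a j ≤ r := fun j => by
    by_contra! hj
    exact hcon (eventually_atTop.2 ⟨j, fun i hi => hj.trans_le (mono hi)⟩)
  have hr0 : 0 < r := (div_pos (pos 1) (pos 0)).trans_le (small 0)
  have decay : ∀ j, a j ≤ a 0 * r ^ j := fun j => by
    induction j with
    | zero => simp
    | succ j ih =>
      have := (div_le_iff₀ (pos j)).1 (small j)
      calc _ ≤ r * a j := this
        _ ≤ r * (a 0 * r ^ j) := by gcongr
        _ = _ := by ring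
  -- The factor `3 ^ D` comes from `2 * j + 1 ≤ 3 * j` for `j ≥ 1`.
  have lim : Tendsto (fun j : ℕ => a 0 * 3 ^ D * ((j : ℝ) ^ D * r ^ j)) atTop (𝓝 0) := by
    simpa using (tendsto_pow_const_mul_const_pow_of_lt_one D hr0.le hr).const_mul (a 0 * 3 ^ D)
  obtain ⟨j, hj1, hj2⟩ := ((lim.eventually_lt_const hc).and (eventually_ge_atTop 1)).exists
  have hj : (1 : ℝ) ≤ j := by exact_mod_cast hj2
  have : a j * (2 * j + 1) ^ D ≤ a 0 * r ^ j * (3 * j) ^ D := by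
    have := pos 0
    exact mul_le_mul (decay j) (pow_le_pow_left₀ (by positivity) (by linarith) D) (by positivity)
      (by positivity)
  rw [mul_pow] at this
  linarith [low j]

/-! ### Estimates of the heat kernel. -/

section

variable {d : ℕ} {β k : Fin d → ℝ}

lemma heat_eq_zero_of_lt (z : Fin d → ℤ) (j : ℕ) (x : Fin d → ℤ) (i : Fin d)
    (hx : (j : ℤ) < |x i - z i|) : heat β k z j x = 0 := by
  induction j generalizing x with
  | zero =>
    have : x ≠ z := by rintro rfl; simp at hx
    simp [heat, this]
  | succ j ih =>
    have key : ∀ y : Fin d → ℤ, |x i - y i| ≤ 1 → heat β k z j y = 0 := fun y hy => ih y (by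
      have := abs_sub_le (x i) (y i) (z i)
      push_cast at hx; linarith)
    have e : ∀ l : Fin d, |(Pi.single l 1 : Fin d → ℤ) i| ≤ 1 := fun l => by
      by_cases h : i = l
      · subst h; simp
      · simp [h]
    rw [heat_succ, jumpAvg, Finset.sum_eq_zero, zero_div]
    intro l _
    rw [key, key]
    · simp
    · simpa using e l
    · simpa using e l

lemma eq_zero_of_l1_eq_zero {x : Fin d → ℤ} (h : l1 x = 0) : x = 0 := by
  funext i
  have := (Finset.sum_eq_zero_iff.1 h) i (Finset.mem_univ i)
  simpa using this

lemma l1_step (x : Fin d → ℤ) (i : Fin d) (v : ℤ) :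
    l1 (x + Pi.single i v) + (x i).natAbs = l1 x + (x i + v).natAbs := by
  unfold l1
  rw [← Finset.add_sum_erase Finset.univ _ (Finset.mem_univ i),
    ← Finset.add_sum_erase Finset.univ (fun l => (x l).natAbs) (Finset.mem_univ i)]
  have : ∑ l ∈ Finset.univ.erase i, ((x + Pi.single i v : Fin d → ℤ) l).natAbs =
      ∑ l ∈ Finset.univ.erase i, (x l).natAbs :=
    Finset.sum_congr rfl fun l hl => by simp [Finset.ne_of_mem_erase hl]
  rw [this]; simp; ring

lemma l1_add_single (x : Fin d → ℤ) (i : Fin d) :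
    l1 (x + Pi.single i 1) = l1 x + 1 ∧ 0 ≤ x i ∨
      l1 (x + Pi.single i 1) + 1 = l1 x ∧ x i < 0 := by
  have := l1_step x i 1; omega

lemma l1_sub_single (x : Fin d → ℤ) (i : Fin d) :
    l1 (x - Pi.single i 1) = l1 x + 1 ∧ x i ≤ 0 ∨
      l1 (x - Pi.single i 1) + 1 = l1 x ∧ 0 < x i := by
  have := l1_step x i (-1)
  rw [Pi.single_neg, ← sub_eq_add_neg] at this
  omega

/-- Each jump flips the parity of the norm, so the jump chain has period two. -/
lemma heat_eq_zero_of_odd (j : ℕ) (x : Fin d → ℤ) (h : (j + l1 x) % 2 = 1) :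
    heat β k 0 j x = 0 := by
  induction j generalizing x with
  | zero =>
    have : x ≠ 0 := by rintro rfl; simp [l1] at h
    simp [heat, this]
  | succ j ih =>
    rw [heat_succ, jumpAvg, Finset.sum_eq_zero, zero_div]
    intro i _
    rw [ih, ih]
    · simp
    · have := l1_sub_single x i; omega
    · have := l1_add_single x i; omega

end

section

variable {d : ℕ} [NeZero d] {β k : Fin d → ℝ}

/-- The value is the squared norm of the kernel after `j` jumps, which is not zero because its total
mass is 1. -/
lemma heat_two_mul_pos (hβ : ∀ i, 0 < β i) (hk : ∀ i, 0 < k i) (z : Fin d → ℤ) (j : ℕ) :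
    0 < heat β k z (2 * j) z := by
  have h := sq_pairing_le hβ hk (finite_support_heat (β := β) (k := k) z j)
    (g := heat β k z 0) (finite_support_heat z 0)
  rw [pairing_heat hβ hk, pairing_heat hβ hk, ← two_mul] at h
  have hnn := heat_nonneg hβ hk z (2 * j) z
  refine hnn.lt_of_ne fun h0 => ?_
  have hs : 0 < pairing β k (heat β k z j) (heat β k z j) := by
    by_contra! hle
    have hzero : ∀ x, heat β k z j x = 0 := by
      intro x
      have hx : weight k x * exitRate β k x * (heat β k z j x * heat β k z j x) ≤ 0 :=
        (((summable_pairing (finite_support_heat z j)).le_tsum x fun y _ =>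
          mul_nonneg (weight_mul_exitRate_pos hβ hk y).le (mul_self_nonneg _))).trans hle
      have := nonpos_of_mul_nonpos_right hx (weight_mul_exitRate_pos hβ hk x)
      nlinarith
    have := pairing_heat_one hβ hk z j
    simp [pairing, hzero] at this
  rw [pairing_heat hβ hk, ← two_mul] at hs
  exact hs.ne h0

/-- Log-convexity of the return densities: Cauchy–Schwarz for the kernels after `j` and `j + 2`
jumps. -/
lemma heat_sq_le (hβ : ∀ i, 0 < β i) (hk : ∀ i, 0 < k i) (z : Fin d → ℤ) (j : ℕ) :
    heat β k z (2 * (j + 1)) z ^ 2 ≤ heat β k z (2 * j) z * heat β k z (2 * (j + 2)) z := by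
  have h := sq_pairing_le hβ hk (finite_support_heat (β := β) (k := k) z j)
    (g := heat β k z (j + 2)) (finite_support_heat z _)
  simp only [pairing_heat hβ hk] at h
  convert h using 3 <;> ring

/-- The on-diagonal kernel decays at most polynomially. -/
lemma exists_le_heat_mul_pow (hβ : ∀ i, 0 < β i) (hk : ∀ i, 0 < k i) :
    ∃ c, 0 < c ∧ ∀ j : ℕ, c ≤ heat β k 0 (2 * j) 0 * (2 * j + 1) ^ d := by
  set M := (∏ i, (1 + k i)) * (2 * ∑ i, (β i + β i / k i)) with hM
  have hle : ∀ x, weight k x * exitRate β k x ≤ M := fun x => by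
    refine mul_le_mul ?_ ?_ (exitRate_pos hβ hk x).le ?_
    · refine Finset.prod_le_prod (fun i _ => ?_) fun i _ => ?_
      · split_ifs; exacts [zero_le_one, (hk i).le]
      · have := hk i
        split_ifs <;> linarith
    · exact mul_le_mul_of_nonneg_left (Finset.sum_le_sum fun i _ => rate_le hβ hk x i) two_pos.le
    · exact Finset.prod_nonneg fun i _ => by have := hk i; linarith
  have hMpos : 0 < M := (weight_mul_exitRate_pos hβ hk 0).trans_le (hle 0)
  refine ⟨M⁻¹, inv_pos.2 hMpos, fun j => ?_⟩
  -- After `j` jumps the chain is in a box of `(2 * j + 1) ^ d` points, each of mass at most `M`.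
  -- Cauchy–Schwarz on this box compares the total mass 1 with the squared norm, which is the return
  -- density.
  set F : Finset (Fin d → ℤ) := Fintype.piFinset fun _ => Finset.Icc (-(j : ℤ)) j with hF
  have hout : ∀ x, x ∉ F → heat β k 0 j x = 0 := fun x hx => by
    simp only [hF, Fintype.mem_piFinset, Finset.mem_Icc, not_forall] at hx
    obtain ⟨i, hi⟩ := hx
    refine heat_eq_zero_of_lt 0 j x i ?_
    rw [Pi.zero_apply, sub_zero]
    by_contra! h
    exact hi (abs_le.1 h)
  have hsum : ∀ g, pairing β k (heat β k 0 j) g =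
      ∑ x ∈ F, weight k x * exitRate β k x * (heat β k 0 j x * g x) := fun g =>
    tsum_eq_sum fun x hx => by simp [hout x hx]
  have h1 := pairing_heat_one hβ hk 0 j
  have h2 := pairing_heat hβ hk 0 0 j j
  rw [hsum] at h1 h2
  have cs := Finset.sum_sq_le_sum_mul_sum_of_sq_le_mul F
    (r := fun x => weight k x * exitRate β k x * (heat β k 0 j x * 1))
    (f := fun x => weight k x * exitRate β k x * (heat β k 0 j x * heat β k 0 j x))
    (g := fun x => weight k x * exitRate β k x)
    (fun x _ => mul_nonneg (weight_mul_exitRate_pos hβ hk x).le (mul_self_nonneg _))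
    (fun x _ => (weight_mul_exitRate_pos hβ hk x).le) (fun x _ => le_of_eq (by ring))
  rw [h1, h2, ← two_mul] at cs
  have card : ∑ x ∈ F, weight k x * exitRate β k x ≤ (2 * j + 1) ^ d * M := by
    have := Finset.sum_le_card_nsmul F _ M fun x _ => hle x
    rw [hF, Fintype.card_piFinset] at this
    simp only [Int.card_Icc, Finset.prod_const, Finset.card_univ, Fintype.card_fin,
      nsmul_eq_mul] at this
    rw [show ((j : ℤ) + 1 - -j).toNat = 2 * j + 1 by omega] at this
    exact_mod_cast this
  rw [inv_le_iff_one_le_mul₀ hMpos]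
  calc (1 : ℝ) = 1 ^ 2 := by norm_num
    _ ≤ _ := cs
    _ ≤ heat β k 0 (2 * j) 0 * ((2 * j + 1) ^ d * M) :=
      mul_le_mul_of_nonneg_left card (heat_nonneg hβ hk _ _ _)
    _ = _ := by ring

lemma antitone_heat (hβ : ∀ i, 0 < β i) (hk : ∀ i, 0 < k i) :
    Antitone fun j => heat β k 0 (2 * j) 0 :=
  antitone_of_sq_le (heat_two_mul_pos hβ hk 0) (fun _ => heat_le hβ hk 0 _ 0) (heat_sq_le hβ hk 0)

lemma tendsto_heat_ratio (hβ : ∀ i, 0 < β i) (hk : ∀ i, 0 < k i) :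
    Tendsto (fun j => heat β k 0 (2 * (j + 1)) 0 / heat β k 0 (2 * j) 0) atTop (𝓝 1) := by
  obtain ⟨c, hc, h⟩ := exists_le_heat_mul_pow hβ hk
  exact tendsto_ratio_of_sq_le (heat_two_mul_pos hβ hk 0) (fun _ => heat_le hβ hk 0 _ 0)
    (heat_sq_le hβ hk 0) hc h

lemma heat_succ_pos (hβ : ∀ i, 0 < β i) (hk : ∀ i, 0 < k i) {j : ℕ} {z x y : Fin d → ℤ} {i : Fin d}
    (hy : y = x + Pi.single i 1 ∨ y = x - Pi.single i 1) (h : 0 < heat β k z j y) :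
    0 < heat β k z (j + 1) x := by
  rw [heat_succ]
  refine div_pos (Finset.sum_pos' (fun l _ => mul_nonneg (rate_pos hβ hk x l).le
    (add_nonneg (heat_nonneg hβ hk _ _ _) (heat_nonneg hβ hk _ _ _))) ⟨i, Finset.mem_univ _,
    mul_pos (rate_pos hβ hk x i) ?_⟩) (exitRate_pos hβ hk x)
  have h1 := heat_nonneg hβ hk z j (x + Pi.single i 1)
  have h2 := heat_nonneg hβ hk z j (x - Pi.single i 1)
  rcases hy with rfl | rfl <;> linarith

lemma heat_l1_pos (hβ : ∀ i, 0 < β i) (hk : ∀ i, 0 < k i) (x : Fin d → ℤ) :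
    0 < heat β k 0 (l1 x) x := by
  induction hn : l1 x generalizing x with
  | zero =>
    have : x = 0 := eq_zero_of_l1_eq_zero hn
    subst this
    exact heat_two_mul_pos hβ hk 0 0
  | succ n ih =>
    have : ∃ i, x i ≠ 0 := by
      by_contra! h
      simp [l1, h] at hn
    obtain ⟨i, hi⟩ := this
    rcases lt_or_gt_of_ne hi with hi | hi
    · exact heat_succ_pos hβ hk (i := i) (Or.inl rfl) (ih _ (by have := l1_add_single x i; omega))
    · exact heat_succ_pos hβ hk (i := i) (Or.inr rfl) (ih _ (by have := l1_sub_single x i; omega))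

lemma heat_zero_le (hβ : ∀ i, 0 < β i) (hk : ∀ i, 0 < k i) {i j : ℕ} (h : 2 * j ≤ i) :
    heat β k 0 i 0 ≤ heat β k 0 (2 * j) 0 := by
  rcases Nat.even_or_odd' i with ⟨m, rfl | rfl⟩
  · exact antitone_heat hβ hk (by omega)
  · rw [heat_eq_zero_of_odd _ _ (by simp [l1])]
    exact heat_nonneg hβ hk _ _ _

/-- The origin reaches `x` in `l1 x` jumps, so kernels from `x` are dominated by kernels from the
origin at later times, and the return densities there do not increase. One constant serves for both
the off-diagonal and the diagonal kernel. -/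
lemma exists_heat_le_mul (hβ : ∀ i, 0 < β i) (hk : ∀ i, 0 < k i) (x : Fin d → ℤ) :
    ∃ C, 0 < C ∧ ∀ i j, 2 * j ≤ i → heat β k 0 i x ≤ C * heat β k 0 (2 * j) 0 ∧
      heat β k x i x ≤ C * heat β k 0 (2 * j) 0 := by
  obtain ⟨C, hC, h⟩ := exists_heat_le hβ hk (heat_l1_pos hβ hk x)
  have h1 : ∀ i j, 2 * j ≤ i → heat β k 0 i x ≤ C * heat β k 0 (2 * j) 0 := fun i j hij => by
    rw [heat_comm hβ hk]
    exact (h i 0).trans (mul_le_mul_of_nonneg_left (heat_zero_le hβ hk (by omega)) hC.le)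
  refine ⟨C + C * C, by positivity, fun i j hij => ⟨(h1 i j hij).trans ?_, ?_⟩⟩
  · have := heat_nonneg hβ hk 0 (2 * j) 0
    gcongr
    nlinarith
  · have h0 := heat_nonneg hβ hk 0 (2 * j) 0
    calc _ ≤ C * heat β k 0 (i + l1 x) x := h i x
      _ ≤ C * (C * heat β k 0 (2 * j) 0) := mul_le_mul_of_nonneg_left (h1 _ _ (by omega)) hC.le
      _ ≤ _ := by nlinarith [mul_nonneg hC.le h0]

/-- The difference is the pairing of `heat 0 (j + 2) - heat 0 j` with `heat x j`. The first squared
norm is the second difference of the return densities `a`, which is `o(a j)` because their ratios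
tend to 1; the second is `O(a j)`. -/
lemma tendsto_heat_diff (hβ : ∀ i, 0 < β i) (hk : ∀ i, 0 < k i) (x : Fin d → ℤ) :
    Tendsto (fun j => (heat β k 0 (2 * j + 2) x - heat β k 0 (2 * j) x) / heat β k 0 (2 * j) 0)
      atTop (𝓝 0) := by
  obtain ⟨C, hC, hle⟩ := exists_heat_le_mul hβ hk x
  have pos := heat_two_mul_pos hβ hk 0
  set a : ℕ → ℝ := fun j => heat β k 0 (2 * j) 0 with ha
  have t1 := tendsto_heat_ratio hβ hk
  have t2 : Tendsto (fun j => a (j + 2) / a j) atTop (𝓝 1) := by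
    have := ((tendsto_add_atTop_iff_nat 1).2 t1).mul t1
    rw [one_mul] at this
    refine this.congr fun j => ?_
    have h1 := (pos j).ne'; have h2 := (pos (j + 1)).ne'
    simp only [ha]
    field_simp
  have bound : Tendsto (fun j => C * (a (j + 2) / a j - 2 * (a (j + 1) / a j) + 1)) atTop (𝓝 0) := by
    have := ((t2.sub (t1.const_mul 2)).add_const 1).const_mul C
    norm_num at this
    exact this
  have sq : Tendsto (fun j => ((heat β k 0 (2 * j + 2) x - heat β k 0 (2 * j) x) / a j) ^ 2)
      atTop (𝓝 0) := by
    refine squeeze_zero (fun j => sq_nonneg _) (fun j => ?_) bound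
    have fs := finite_support_heat (β := β) (k := k) (0 : Fin d → ℤ)
    have cs := sq_pairing_le hβ hk (f := heat β k 0 (j + 2) - heat β k 0 j)
      (((fs (j + 2)).union (fs j)).subset (Function.support_sub _ _))
      (finite_support_heat (β := β) (k := k) x j)
    rw [pairing_sub_left (fs _) (fs _), pairing_sub_self (fs _) (fs _)] at cs
    simp only [pairing_heat hβ hk] at cs
    rw [heat_comm hβ hk x, heat_comm hβ hk x, show j + 2 + j = 2 * j + 2 by ring, ← two_mul,
      show j + 2 + (j + 2) = 2 * (j + 2) by ring, show 2 * j + 2 = 2 * (j + 1) by ring] at cs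
    have hx := (hle (2 * j) j le_rfl).2
    -- Log-convexity and the inequality of arithmetic and geometric means.
    have hnn : 0 ≤ a (j + 2) - 2 * a (j + 1) + a j := by
      nlinarith [heat_sq_le hβ hk 0 j, pos j, pos (j + 2), sq_nonneg (a j - a (j + 2)),
        pos (j + 1)]
    have pj : 0 < a j := pos j
    rw [div_pow, div_le_iff₀ (by positivity), show 2 * j + 2 = 2 * (j + 1) by ring]
    calc _ ≤ _ := cs
      _ ≤ (a (j + 2) - 2 * a (j + 1) + a j) * (C * a j) := mul_le_mul_of_nonneg_left hx hnn
      _ = _ := by field_simp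
  have := (Real.continuous_sqrt.tendsto 0).comp sq
  simp only [Function.comp_def, Real.sqrt_sq_eq_abs, Real.sqrt_zero] at this
  exact (tendsto_zero_iff_abs_tendsto_zero _).2 this

end

/-! ### Nonnegative harmonic functions and the ratio limit theorem. -/

/-- By concavity a negative increment persists to the right and drives the function below zero. -/
lemma le_succ_of_concave_int {f : ℤ → ℝ} (h0 : ∀ n, 0 ≤ f n)
    (hc : ∀ n, f (n + 1) + f (n - 1) ≤ 2 * f n) (n : ℤ) : f n ≤ f (n + 1) := by
  have anti : Antitone fun m => f (m + 1) - f m := antitone_int_of_succ_le fun m => by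
    have := hc (m + 1)
    rw [add_sub_cancel_right] at this
    linarith
  by_contra! hlt
  have lin : ∀ m : ℕ, f (n + m) ≤ f n + m * (f (n + 1) - f n) := fun m => by
    induction m with
    | zero => simp
    | succ m ih =>
      have := anti (show n ≤ n + m by omega)
      simp only at this
      push_cast
      rw [← add_assoc]
      linarith
  obtain ⟨m, hm⟩ := exists_nat_gt (f n / (f n - f (n + 1)))
  rw [div_lt_iff₀ (by linarith)] at hm
  linarith [lin m, h0 (n + m)]

/-- A nonnegative concave function on `ℤ` is constant. -/
lemma eq_of_concave_int {f : ℤ → ℝ} (h0 : ∀ n, 0 ≤ f n)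
    (hc : ∀ n, f (n + 1) + f (n - 1) ≤ 2 * f n) (n : ℤ) : f (n + 1) = f n := by
  refine le_antisymm ?_ (le_succ_of_concave_int h0 hc n)
  have := le_succ_of_concave_int (f := fun m => f (-m)) (fun m => h0 _) (fun m => ?_) (-(n + 1))
  · simpa using this
  · have := hc (-m)
    rw [show -(m + 1) = -m - 1 by ring, show -(m - 1) = -m + 1 by ring]
    linarith

/-- The part of the generator of the walk that moves the coordinate `i`. -/
def coordGen {d : ℕ} (β k : Fin d → ℝ) (i : Fin d) (h : (Fin d → ℤ) → ℝ) (x : Fin d → ℤ) : ℝ :=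
  rate β k x i * (h (x + Pi.single i 1) + h (x - Pi.single i 1) - 2 * h x)

/-- The nonnegative harmonic functions of the walk with value `1` at the origin. -/
def harmonics {d : ℕ} (β k : Fin d → ℝ) : Set ((Fin d → ℤ) → ℝ) :=
  {h | (∀ x, 0 ≤ h x) ∧ h 0 = 1 ∧ ∀ x, ∑ i, coordGen β k i h x = 0}

section

variable {d : ℕ} {β k : Fin d → ℝ}

lemma coordGen_comb (i : Fin d) (s t : ℝ) (f g : (Fin d → ℤ) → ℝ) (x : Fin d → ℤ) :
    coordGen β k i (fun y => s * f y + t * g y) x =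
      s * coordGen β k i f x + t * coordGen β k i g x := by
  simp only [coordGen]; ring

lemma rate_congr {x y : Fin d → ℤ} {i : Fin d} (h : x i = y i) :
    rate β k x i = rate β k y i := by simp [rate, h]

/-- The rate in direction `i` depends on `x i` alone, so generators of different directions act on
separate variables. -/
lemma coordGen_comm (i l : Fin d) (h : (Fin d → ℤ) → ℝ) (x : Fin d → ℤ) :
    coordGen β k i (coordGen β k l h) x = coordGen β k l (coordGen β k i h) x := by
  by_cases hil : i = l
  · rw [hil]
  have hli : l ≠ i := Ne.symm hil
  simp only [coordGen]
  rw [rate_congr (x := x + Pi.single i 1) (y := x) (i := l) (by simp [hli]),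
    rate_congr (x := x - Pi.single i 1) (y := x) (i := l) (by simp [hli]),
    rate_congr (x := x + Pi.single l 1) (y := x) (i := i) (by simp [hil]),
    rate_congr (x := x - Pi.single l 1) (y := x) (i := i) (by simp [hil]),
    add_right_comm x (Pi.single l 1), sub_right_comm x (Pi.single l 1),
    add_sub_right_comm x (Pi.single l 1), ← add_sub_right_comm x (Pi.single i 1)]
  ring

lemma sum_coordGen_coordGen {h : (Fin d → ℤ) → ℝ} (hh : ∀ x, ∑ i, coordGen β k i h x = 0)
    (i : Fin d) (x : Fin d → ℤ) : ∑ l, coordGen β k l (coordGen β k i h) x = 0 := by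
  simp_rw [fun l => coordGen_comm (β := β) (k := k) l i h x]
  simp only [coordGen]
  simp only [coordGen] at hh
  rw [← Finset.mul_sum, Finset.sum_sub_distrib, Finset.sum_add_distrib, ← Finset.mul_sum, hh, hh,
    hh]
  ring

lemma convex_harmonics : Convex ℝ (harmonics β k) := by
  rintro f ⟨f0, f1, fh⟩ g ⟨g0, g1, gh⟩ s t hs ht hst
  refine ⟨fun x => ?_, ?_, fun x => ?_⟩
  · exact add_nonneg (mul_nonneg hs (f0 x)) (mul_nonneg ht (g0 x))
  · simp [f1, g1, hst]
  · have : (s • f + t • g) = fun y => s * f y + t * g y := rfl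
    simp_rw [this, coordGen_comb]
    rw [Finset.sum_add_distrib, ← Finset.mul_sum, ← Finset.mul_sum, fh, gh]
    ring

lemma harmonics_sum_eq {h : (Fin d → ℤ) → ℝ} (hh : ∀ x, ∑ i, coordGen β k i h x = 0)
    (x : Fin d → ℤ) :
    ∑ i, rate β k x i * (h (x + Pi.single i 1) + h (x - Pi.single i 1)) =
      exitRate β k x * h x := by
  have := hh x
  simp only [coordGen, mul_sub] at this
  rw [Finset.sum_sub_distrib, sub_eq_zero] at this
  simp only [this, exitRate, Finset.mul_sum, Finset.sum_mul]
  exact Finset.sum_congr rfl fun i _ => by ring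

/-- A Harnack inequality: in the mean value identity at `x` all terms are nonnegative, so each is at
most the whole. -/
lemma harmonics_neighbour_le (hβ : ∀ i, 0 < β i) (hk : ∀ i, 0 < k i) {h : (Fin d → ℤ) → ℝ}
    (hh : h ∈ harmonics β k) {x y : Fin d → ℤ} {i : Fin d}
    (hy : y = x + Pi.single i 1 ∨ y = x - Pi.single i 1) :
    h y ≤ exitRate β k x / rate β k x i * h x := by
  have hr := rate_pos hβ hk x i
  have h1 := Finset.single_le_sum (f := fun i => rate β k x i *
    (h (x + Pi.single i 1) + h (x - Pi.single i 1))) (fun l _ => mul_nonneg (rate_pos hβ hk x l).le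
      (add_nonneg (hh.1 _) (hh.1 _))) (Finset.mem_univ i)
  rw [harmonics_sum_eq hh.2.2] at h1
  rw [div_mul_eq_mul_div, le_div_iff₀ hr, mul_comm]
  refine le_trans (mul_le_mul_of_nonneg_left ?_ hr.le) h1
  have := hh.1 (x + Pi.single i 1)
  have := hh.1 (x - Pi.single i 1)
  rcases hy with rfl | rfl <;> linarith

/-- Chain the Harnack inequality along a path from the origin, where the value is 1. These pointwise
bounds make `harmonics` compact in the product topology. -/
lemma harmonics_bounded (hβ : ∀ i, 0 < β i) (hk : ∀ i, 0 < k i) (x : Fin d → ℤ) :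
    ∃ C, ∀ h ∈ harmonics β k, h x ≤ C := by
  induction hn : l1 x generalizing x with
  | zero =>
    have : x = 0 := eq_zero_of_l1_eq_zero hn
    subst this
    exact ⟨1, fun h hh => hh.2.1.le⟩
  | succ n ih =>
    have : ∃ i, x i ≠ 0 := by
      by_contra! h
      simp [l1, h] at hn
    obtain ⟨i, hi⟩ := this
    have : ∃ y, l1 y = n ∧ (x = y + Pi.single i 1 ∨ x = y - Pi.single i 1) := by
      rcases lt_or_gt_of_ne hi with hi | hi
      · exact ⟨x + Pi.single i 1, by have := l1_add_single x i; omega, Or.inr (by simp)⟩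
      · exact ⟨x - Pi.single i 1, by have := l1_sub_single x i; omega, Or.inl (by simp)⟩
    obtain ⟨y, hy, hxy⟩ := this
    obtain ⟨C, hC⟩ := ih y hy
    refine ⟨exitRate β k y / rate β k y i * C, fun h hh =>
      (harmonics_neighbour_le hβ hk hh hxy).trans (mul_le_mul_of_nonneg_left (hC h hh) ?_)⟩
    exact div_nonneg (mul_nonneg two_pos.le (Finset.sum_nonneg fun l _ => (rate_pos hβ hk y l).le))
      (rate_pos hβ hk y i).le

lemma isCompact_harmonics (hβ : ∀ i, 0 < β i) (hk : ∀ i, 0 < k i) :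
    IsCompact (harmonics β k) := by
  choose C hC using harmonics_bounded hβ hk
  refine (isCompact_univ_pi fun x => isCompact_Icc (a := 0) (b := C x)).of_isClosed_subset ?_
    fun h hh x _ => ⟨hh.1 x, hC x h hh⟩
  simp only [harmonics, Set.ofPred_and, Set.ofPred_forall, coordGen]
  refine (isClosed_iInter fun x => isClosed_le (by fun_prop) (by fun_prop)).inter
    ((isClosed_eq (by fun_prop) (by fun_prop)).inter
      (isClosed_iInter fun x => isClosed_eq (by fun_prop) (by fun_prop)))

/-- For large `M` the function `coordGen i h + 2 * M * h` is nonnegative, harmonic and bounded by a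
multiple of `h`. Hence `h` is a proper convex combination of its normalisation and the normalised
remainder, and extremality makes it proportional to `h`. -/
lemma coordGen_eq_mul_of_mem_extremePoints [NeZero d] (hβ : ∀ i, 0 < β i) (hk : ∀ i, 0 < k i)
    {h : (Fin d → ℤ) → ℝ} (hh : h ∈ (harmonics β k).extremePoints ℝ) (i : Fin d)
    (x : Fin d → ℤ) : coordGen β k i h x = coordGen β k i h 0 * h x := by
  obtain ⟨⟨h0, h1, hL⟩, hext⟩ := mem_extremePoints.1 hh
  obtain ⟨M, hM0, hM⟩ : ∃ M, 0 < M ∧ ∀ x l, rate β k x l < M := by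
    refine ⟨1 + ∑ l, (β l + β l / k l), ?_, fun x l => ?_⟩
    · have : 0 ≤ ∑ l, (β l + β l / k l) := Finset.sum_nonneg fun l _ => by
        have := hβ l; have := hk l; positivity
      linarith
    · have h1 := rate_le hβ hk x l
      have h2 := Finset.single_le_sum (f := fun l => β l + β l / k l) (fun l _ => by
        have := hβ l; have := hk l; positivity) (Finset.mem_univ l)
      linarith
  set B : Fin d → (Fin d → ℤ) → ℝ := fun l y => coordGen β k l h y + 2 * M * h y with hB
  have hBeq : ∀ l y, B l y = rate β k y l * (h (y + Pi.single l 1) + h (y - Pi.single l 1)) +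
      2 * (M - rate β k y l) * h y := fun l y => by simp only [hB, coordGen]; ring
  have hBnn : ∀ l y, 0 ≤ B l y := fun l y => by
    rw [hBeq]
    have := rate_pos hβ hk y l
    have := hM y l
    have := h0 (y + Pi.single l 1)
    have := h0 (y - Pi.single l 1)
    exact add_nonneg (mul_nonneg (by linarith) (by linarith))
      (mul_nonneg (by linarith) (h0 y))
  have hB0 : 0 < B i 0 := by
    rw [hBeq, h1]
    have := rate_pos hβ hk 0 i
    have := hM 0 i
    have := h0 (0 + Pi.single i 1)
    have := h0 (0 - Pi.single i 1)
    exact add_pos_of_nonneg_of_pos (mul_nonneg (by linarith) (by linarith)) (by linarith)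
  have hd : (0 : ℝ) < d := by exact_mod_cast Nat.pos_of_ne_zero (NeZero.ne d)
  -- The functions `B l` are nonnegative and add up to `2 * d * M * h`, because the coordinate
  -- generators of `h` cancel.
  have hBle : ∀ y, B i y ≤ 2 * d * M * h y := fun y => by
    have := Finset.single_le_sum (f := fun l => B l y) (fun l _ => hBnn l y) (Finset.mem_univ i)
    refine this.trans (le_of_eq ?_)
    simp only [hB, Finset.sum_add_distrib, hL, Finset.sum_const, Finset.card_univ,
      Fintype.card_fin, nsmul_eq_mul]
    ring
  have hBL : ∀ y, ∑ l, coordGen β k l (B i) y = 0 := fun y => by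
    have : B i = fun y => 1 * coordGen β k i h y + 2 * M * h y := by simp [hB]
    simp_rw [this, coordGen_comb]
    rw [Finset.sum_add_distrib, ← Finset.mul_sum, ← Finset.mul_sum, sum_coordGen_coordGen hL, hL]
    ring
  -- With this `c` the part `c * B i` is at most `h / 2`, so the remainder `h - c * B i` is
  -- nonnegative and positive at the origin.
  set c : ℝ := (4 * d * M)⁻¹ with hc
  have hc0 : 0 < c := by positivity
  have hcM : c * (2 * d * M) = 1 / 2 := by rw [hc]; field_simp; norm_num
  have hcB : ∀ y, c * B i y ≤ 1 / 2 * h y := fun y => by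
    have := mul_le_mul_of_nonneg_left (hBle y) hc0.le
    rwa [← mul_assoc, hcM] at this
  set a : ℝ := c * B i 0 with ha
  have ha0 : 0 < a := mul_pos hc0 hB0
  have ha1 : a ≤ 1 / 2 := by have := hcB 0; rw [h1] at this; linarith
  have hg1 : (fun y => (B i 0)⁻¹ * B i y + 0 * h y) ∈ harmonics β k := by
    refine ⟨fun y => ?_, ?_, fun y => ?_⟩
    · have := mul_nonneg (inv_nonneg.2 hB0.le) (hBnn i y); linarith
    · simp [hB0.ne']
    · simp_rw [coordGen_comb]
      rw [Finset.sum_add_distrib, ← Finset.mul_sum, ← Finset.mul_sum, hBL, hL]; ring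
  have hg2 : (fun y => (1 - a)⁻¹ * h y + (-(1 - a)⁻¹ * c) * B i y) ∈ harmonics β k := by
    have h1a : 0 < (1 - a)⁻¹ := inv_pos.2 (by linarith)
    refine ⟨fun y => ?_, ?_, fun y => ?_⟩
    · have := mul_nonneg h1a.le (show 0 ≤ h y - c * B i y by linarith [hcB y, h0 y]); linarith
    · have : 1 - a ≠ 0 := by linarith
      change (1 - a)⁻¹ * h 0 + -(1 - a)⁻¹ * c * B i 0 = 1
      rw [h1, mul_assoc, ← ha]; field_simp; ring
    · simp_rw [coordGen_comb]
      rw [Finset.sum_add_distrib, ← Finset.mul_sum, ← Finset.mul_sum, hBL, hL]; ring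
  have hseg := (hext _ hg1 _ hg2 ⟨a, 1 - a, ha0, by linarith, by ring, by
    funext y
    have : 1 - a ≠ 0 := by linarith
    have : B i 0 ≠ 0 := hB0.ne'
    simp only [Pi.add_apply, Pi.smul_apply, smul_eq_mul]
    rw [ha]
    rw [ha] at *
    field_simp
    ring⟩).1
  have hx := congrFun hseg x
  simp only [zero_mul, add_zero] at hx
  rw [inv_mul_eq_iff_eq_mul₀ hB0.ne'] at hx
  simp only [hB, h1] at hx
  linarith

/-- An eigenvalue `μ i ≤ 0` makes `h` concave, hence constant, along direction `i`, which gives `μ i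
= 0`. So no eigenvalue is negative; as they sum to zero, all vanish and `h` is constant in every
direction. -/
lemma eq_of_sum_eq_zero_of_coordGen (hβ : ∀ i, 0 < β i) (hk : ∀ i, 0 < k i)
    {h : (Fin d → ℤ) → ℝ} (h0 : ∀ x, 0 ≤ h x) (h1 : h 0 = 1) {μ : Fin d → ℝ} (hμ : ∑ i, μ i = 0)
    (hg : ∀ i x, coordGen β k i h x = μ i * h x) (x : Fin d → ℤ) : h x = 1 := by
  have line : ∀ i, μ i ≤ 0 → ∀ x, h (x + Pi.single i 1) = h x := fun i hi x => by
    have := eq_of_concave_int (f := fun n : ℤ => h (x + Pi.single i n)) (fun n => h0 _)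
      (fun n => ?_) 0
    · simpa using this
    · have := hg i (x + Pi.single i n)
      rw [coordGen, add_assoc, ← Pi.single_add,
        add_sub_assoc x (Pi.single i n) (Pi.single i 1), ← Pi.single_sub] at this
      have hle : μ i * h (x + Pi.single i n) ≤ 0 := mul_nonpos_of_nonpos_of_nonneg hi (h0 _)
      rw [← this] at hle
      have := nonpos_of_mul_nonpos_right hle (rate_pos hβ hk _ i)
      linarith
  have nonneg : ∀ i, 0 ≤ μ i := fun i => by
    by_contra! hi
    have e1 := line i hi.le 0
    have e2 := line i hi.le (0 - Pi.single i 1)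
    have := hg i 0
    rw [coordGen, e1, ← e2, sub_add_cancel, h1] at this
    norm_num at this
    exact hi.ne this.symm
  have zero : ∀ i, μ i = 0 := fun i =>
    (Finset.sum_eq_zero_iff_of_nonneg fun i _ => nonneg i).1 hμ i (Finset.mem_univ i)
  induction hn : l1 x generalizing x with
  | zero =>
    have : x = 0 := eq_zero_of_l1_eq_zero hn
    rw [this, h1]
  | succ n ih =>
    have : ∃ i, x i ≠ 0 := by
      by_contra! h
      simp [l1, h] at hn
    obtain ⟨i, hi⟩ := this
    rcases lt_or_gt_of_ne hi with hi | hi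
    · rw [← line i (zero i).le]
      exact ih _ (by have := l1_add_single x i; omega)
    · rw [← sub_add_cancel x (Pi.single i 1), line i (zero i).le]
      exact ih _ (by have := l1_sub_single x i; omega)

/-- The walk has no nonconstant nonnegative harmonic functions. -/
lemma eq_one_of_mem_harmonics [NeZero d] (hβ : ∀ i, 0 < β i) (hk : ∀ i, 0 < k i)
    {h : (Fin d → ℤ) → ℝ} (hh : h ∈ harmonics β k) (x : Fin d → ℤ) : h x = 1 := by
  have ext : (harmonics β k).extremePoints ℝ ⊆ {fun _ => 1} := fun g hgm => by
    obtain ⟨g0, g1, gL⟩ := hgm.1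
    exact funext fun y => eq_of_sum_eq_zero_of_coordGen hβ hk g0 g1 (gL 0)
      (coordGen_eq_mul_of_mem_extremePoints hβ hk hgm) y
  -- Krein–Milman: `harmonics` is the closed convex hull of its extreme points, and the constant 1
  -- is the only candidate.
  rw [← closure_convexHull_extremePoints (isCompact_harmonics hβ hk) convex_harmonics] at hh
  have := closure_mono (convexHull_mono ext) hh
  rw [convexHull_singleton, closure_singleton] at this
  rw [this]

/-- The ratio limit theorem for the jump chain. -/
lemma tendsto_heat_add_div [NeZero d] (hβ : ∀ i, 0 < β i) (hk : ∀ i, 0 < k i) (x : Fin d → ℤ) :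
    Tendsto (fun j => (heat β k 0 (2 * j) x + heat β k 0 (2 * j + 1) x) / heat β k 0 (2 * j) 0)
      atTop (𝓝 1) := by
  have pos := heat_two_mul_pos hβ hk 0
  have nn := heat_nonneg hβ hk 0
  -- By parity at most one of the two summands is nonzero. Adding them makes the generator
  -- telescope: applied to `H j` it leaves only the difference of the kernels after `2 * j + 2` and
  -- `2 * j` jumps, times the exit rate.
  set H : ℕ → (Fin d → ℤ) → ℝ := fun j x =>
    (heat β k 0 (2 * j) x + heat β k 0 (2 * j + 1) x) / heat β k 0 (2 * j) 0 with hH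
  choose C hC hle using exists_heat_le_mul hβ hk
  -- Along an ultrafilter compactness supplies a pointwise limit, so it suffices to identify that
  -- limit as a member of `harmonics`.
  rw [tendsto_iff_ultrafilter]
  intro u hu
  have cpt : IsCompact (Set.univ.pi fun x => Set.Icc 0 (2 * C x)) :=
    isCompact_univ_pi fun x => isCompact_Icc
  obtain ⟨h, -, hlim⟩ := cpt.ultrafilter_le_nhds (u.map H) (by
    refine le_principal_iff.2 (Ultrafilter.mem_map.2 (univ_mem' fun j y _ => ⟨?_, ?_⟩))
    · exact div_nonneg (add_nonneg (nn _ _) (nn _ _)) (nn _ _)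
    · rw [div_le_iff₀ (pos j)]
      linarith [(hle y (2 * j) j le_rfl).1, (hle y (2 * j + 1) j (by omega)).1])
  have ht : ∀ y, Tendsto (fun j => H j y) u (𝓝 (h y)) := tendsto_pi_nhds.1 hlim
  have mem : h ∈ harmonics β k := by
    refine ⟨fun y => ge_of_tendsto' (ht y) fun j => ?_, ?_, fun y => ?_⟩
    · exact div_nonneg (add_nonneg (nn _ _) (nn _ _)) (nn _ _)
    · refine tendsto_nhds_unique (ht 0) (tendsto_const_nhds.congr fun j => ?_)
      simp only [hH]
      rw [heat_eq_zero_of_odd (2 * j + 1) 0 (by simp [l1]), add_zero, div_self (pos j).ne']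
    · have t1 : Tendsto (fun j => ∑ i, coordGen β k i (H j) y) u
          (𝓝 (∑ i, coordGen β k i h y)) :=
        tendsto_finsetSum _ fun i _ =>
          (((ht _).add (ht _)).sub ((ht _).const_mul 2)).const_mul _
      have t2 := ((tendsto_heat_diff hβ hk y).mono_left hu).const_mul (exitRate β k y)
      rw [mul_zero] at t2
      refine tendsto_nhds_unique t1 (t2.congr fun j => ?_)
      have e1 := exitRate_mul_jumpAvg hβ hk (heat β k 0 (2 * j)) y
      have e2 := exitRate_mul_jumpAvg hβ hk (heat β k 0 (2 * j + 1)) y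
      rw [← heat_succ] at e1 e2
      have hp := (pos j).ne'
      have e3 : ∑ i, coordGen β k i (H j) y =
          (∑ i, rate β k y i * (heat β k 0 (2 * j) (y + Pi.single i 1) +
              heat β k 0 (2 * j) (y - Pi.single i 1)) +
            ∑ i, rate β k y i * (heat β k 0 (2 * j + 1) (y + Pi.single i 1) +
              heat β k 0 (2 * j + 1) (y - Pi.single i 1)) -
            exitRate β k y * (heat β k 0 (2 * j) y + heat β k 0 (2 * j + 1) y)) /
              heat β k 0 (2 * j) 0 := by
        rw [exitRate, mul_assoc, Finset.sum_mul, Finset.mul_sum, ← Finset.sum_add_distrib,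
          ← Finset.sum_sub_distrib, Finset.sum_div]
        refine Finset.sum_congr rfl fun i _ => ?_
        simp only [coordGen, hH]
        field_simp
        ring
      rw [e3, ← e1, ← e2]
      ring
  have := ht x
  rwa [eq_one_of_mem_harmonics hβ hk mem x] at this

end

/-! ### Jump counts and active times of a path. -/

/-- The number of changes of the norm along a path before time `t`. -/
def jumpCount {d : ℕ} (x : ℕ → Fin d → ℤ) : ℕ → ℕ
  | 0 => 0
  | t + 1 => jumpCount x t + if l1 (x (t + 1)) = l1 (x t) then 0 else 1

section Path

variable {d : ℕ} {x : ℕ → Fin d → ℤ}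

lemma jumpCount_congr {y : ℕ → Fin d → ℤ} {t : ℕ} (h : ∀ s ≤ t, x s = y s) :
    jumpCount x t = jumpCount y t := by
  induction t with
  | zero => rfl
  | succ t ih =>
    rw [jumpCount, jumpCount, ih fun s hs => h s (by omega), h _ le_rfl, h t (by omega)]

lemma monotone_jumpCount : Monotone (jumpCount x) :=
  monotone_nat_of_le_succ fun _ => Nat.le_add_right _ _

lemma l1_eq_of_jumpCount_eq {s t : ℕ} (hst : s ≤ t) (h : jumpCount x t = jumpCount x s) :
    l1 (x t) = l1 (x s) := by
  induction t, hst using Nat.le_induction with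
  | base => rfl
  | succ t hst ih =>
    have h1 := monotone_jumpCount (x := x) hst
    have h2 : jumpCount x (t + 1) = jumpCount x t + _ := rfl
    split_ifs at h2 with h3
    · rw [h3, ih (by omega)]
    · omega

/-- On a path with infinitely many jumps the infimum in `activeTime` is over a nonempty set, and the
active time is the first time with jump count `j`. Without this the infimum could take its default
value 0. -/
lemma activeTime_spec (h : ∀ j, ∃ t, jumpCount x t = j ∧ jumpCount x (t + 1) = j + 1) (j : ℕ) :
    jumpCount x (activeTime x j) = j ∧ ∀ u < activeTime x j, jumpCount x u < j := by
  induction j with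
  | zero => exact ⟨rfl, fun u hu => absurd hu (Nat.not_lt_zero u)⟩
  | succ j ih =>
    obtain ⟨t, ht, ht'⟩ := h j
    have hle : activeTime x j ≤ t := by
      by_contra! hlt
      have := ih.2 t hlt; omega
    have hl := l1_eq_of_jumpCount_eq hle (ht.trans ih.1.symm)
    have hT : activeTime x (j + 1) = t + 1 := by
      refine IsLeast.csInf_eq ⟨⟨by omega, fun heq => ?_⟩, fun u hu => ?_⟩
      · rw [jumpCount, if_pos (heq.trans hl.symm)] at ht'; omega
      · by_contra! hlt
        refine hu.2 (l1_eq_of_jumpCount_eq hu.1.le ?_)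
        have h1 := monotone_jumpCount (x := x) hu.1.le
        have h2 := monotone_jumpCount (x := x) (show u ≤ t by omega)
        omega
    rw [hT]
    refine ⟨ht', fun u hu => ?_⟩
    have := monotone_jumpCount (x := x) (show u ≤ t by omega)
    omega

lemma l1_eq_activeTime (h : ∀ j, ∃ t, jumpCount x t = j ∧ jumpCount x (t + 1) = j + 1) {t j : ℕ}
    (ht : jumpCount x t = j) : l1 (x t) = l1 (x (activeTime x j)) := by
  have hs := activeTime_spec h j
  refine l1_eq_of_jumpCount_eq ?_ (ht.trans hs.1.symm)
  by_contra! hlt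
  have := hs.2 t hlt; omega

end Path

/-! ### Increments, and the law of the walk in terms of the heat kernel. -/

/-- The possible increments of the walk. -/
def move {d : ℕ} : Option (Fin d × Bool) → Fin d → ℤ
  | none => 0
  | some (i, true) => Pi.single i 1
  | some (i, false) => -Pi.single i 1

/-- The probabilities of the increments from the state `x`. -/
def moveProb {d : ℕ} (β k : Fin d → ℝ) (x : Fin d → ℤ) : Option (Fin d × Bool) → ℝ
  | none => 1 - exitRate β k x
  | some (i, _) => rate β k x i

section Move

variable {d : ℕ} {β k : Fin d → ℝ}

lemma move_injective : Function.Injective (move (d := d)) := by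
  have key : ∀ i l : Fin d, (Pi.single i 1 : Fin d → ℤ) l = if l = i then 1 else 0 := fun i l => by
    rw [Pi.single_apply]
  rintro (_ | ⟨i, _ | _⟩) (_ | ⟨l, _ | _⟩) h <;> simp only [move] at h
  all_goals first
    | rfl
    | (have h1 := congrFun h i
       simp only [Pi.zero_apply, Pi.neg_apply, key] at h1
       split_ifs at h1 with h2 <;> simp_all)
    | (have h1 := congrFun h l
       simp at h1)

lemma sum_moveProb (x : Fin d → ℤ) : ∑ m, moveProb β k x m = 1 := by
  simp only [Fintype.sum_option, Fintype.sum_prod_type, Fintype.sum_bool, moveProb, exitRate,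
    Finset.sum_add_distrib]
  ring

/-- Jumps of the norm are thus exactly the nonzero steps of the walk. -/
lemma l1_add_move_ne (x : Fin d → ℤ) {m : Option (Fin d × Bool)} (hm : m ≠ none) :
    l1 (x + move m) ≠ l1 x := by
  obtain _ | ⟨i, _ | _⟩ := m
  · exact absurd rfl hm
  · rw [move, ← sub_eq_add_neg]
    have := l1_sub_single x i; omega
  · rw [move]
    have := l1_add_single x i; omega

lemma moveProb_nonneg (hβ : ∀ i, 0 < β i) (hk : ∀ i, 0 < k i) (hR : ∀ x, exitRate β k x ≤ 1)
    (x : Fin d → ℤ) (m : Option (Fin d × Bool)) : 0 ≤ moveProb β k x m := by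
  obtain _ | ⟨i, b⟩ := m
  · exact sub_nonneg.2 (hR x)
  · exact (rate_pos hβ hk x i).le

end Move

/-- Summing the recursion over time telescopes. Nonnegativity turns the telescoped identity into a
bound on partial sums, hence summability, and the recursion then determines the sum. -/
lemma hasSum_of_linear_recursion {n s : ℕ → ℝ} {R σ : ℝ} (hn : ∀ t, 0 ≤ n t) (hs : ∀ t, 0 ≤ s t)
    (hR : 0 < R) (hrec : ∀ t, n (t + 1) = (1 - R) * n t + s t) (hσ : HasSum s σ) :
    HasSum n ((n 0 + σ) / R) := by
  have part : ∀ T, R * ∑ t ∈ Finset.range T, n t = n 0 - n T + ∑ t ∈ Finset.range T, s t :=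
    fun T => by
      induction T with
      | zero => simp
      | succ T ih => rw [Finset.sum_range_succ, Finset.sum_range_succ, mul_add, ih, hrec]; ring
  have sm : Summable n := summable_of_sum_range_le (c := (n 0 + σ) / R) hn fun T => by
    rw [le_div_iff₀ hR, mul_comm, part]
    linarith [hn T, sum_le_hasSum (Finset.range T) (fun t _ => hs t) hσ]
  have h1 := (sm.hasSum.mul_left (1 - R)).add hσ
  simp_rw [← hrec] at h1
  have h2 := (hasSum_nat_add_iff 1).1 h1
  have h3 := h2.unique sm.hasSum
  rw [Finset.sum_range_one] at h3
  convert sm.hasSum using 1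
  rw [div_eq_iff hR.ne']
  linarith

section Walk

variable {d : ℕ} {β k : Fin d → ℝ} {Ω : Type*} [MeasurableSpace Ω] {P : Measure Ω}
  {S : ℕ → Ω → Fin d → ℤ}

lemma IsWalk.measureReal_history (hS : IsWalk (rate β k) P S) (t : ℕ) (x : ℕ → Fin d → ℤ)
    (m : Option (Fin d × Bool)) :
    P.real (history S x t ∩ {ω | S (t + 1) ω = x t + move m}) =
      P.real (history S x t) * moveProb β k (x t) m := by
  obtain _ | ⟨i, _ | _⟩ := m
  · simpa [move, moveProb, exitRate] using hS.step_zero t x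
  · simpa [move, moveProb, sub_eq_add_neg] using hS.step_neg t x i
  · exact hS.step_pos t x i

/-- The event that at time `t` the path is in `x` after `j` changes of its norm. -/
def visit (S : ℕ → Ω → Fin d → ℤ) (j t : ℕ) (x : Fin d → ℤ) : Set Ω :=
  {ω | jumpCount (fun s => S s ω) t = j ∧ S t ω = x}

lemma IsWalk.measurable_jumpCount (hS : IsWalk (rate β k) P S) (t : ℕ) :
    Measurable fun ω => jumpCount (fun s => S s ω) t := by
  have ml : ∀ t, Measurable fun ω => l1 (S t ω) := fun t =>
    (Measurable.of_discrete (f := l1)).comp (hS.measurable t)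
  induction t with
  | zero => exact measurable_const
  | succ t ih =>
    exact ih.add (Measurable.ite (measurableSet_eq_fun (ml _) (ml _)) measurable_const
      measurable_const)

lemma IsWalk.measurableSet_visit (hS : IsWalk (rate β k) P S) (j t : ℕ) (x : Fin d → ℤ) :
    MeasurableSet (visit S j t x) :=
  (hS.measurable_jumpCount t (measurableSet_singleton j)).inter
    (hS.measurable t (measurableSet_singleton x))

variable [IsProbabilityMeasure P]

/-- The Markov property. -/
lemma IsWalk.measureReal_step (hS : IsWalk (rate β k) P S) (hβ : ∀ i, 0 < β i) (hk : ∀ i, 0 < k i)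
    (hR : ∀ x, exitRate β k x ≤ 1) (t : ℕ) (C : Set (Fin (t + 1) → Fin d → ℤ)) (x : Fin d → ℤ)
    (m : Option (Fin d × Bool)) :
    P.real {ω | ((fun s : Fin (t + 1) => S s ω) ∈ C ∧ S t ω = x) ∧ S (t + 1) ω = x + move m} =
      P.real {ω | (fun s : Fin (t + 1) => S s ω) ∈ C ∧ S t ω = x} * moveProb β k x m := by
  set pre : Ω → Fin (t + 1) → Fin d → ℤ := fun ω s => S s ω with hpre
  have mpre : Measurable pre := measurable_pi_lambda _ fun s => hS.measurable s
  have hρ := moveProb_nonneg hβ hk hR x m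
  set F : Set Ω := {ω | S (t + 1) ω = x + move m}
  have mF : MeasurableSet F := hS.measurable _ (measurableSet_singleton _)
  set L : Set (Fin (t + 1) → Fin d → ℤ) := {c | c (Fin.last t) = x}
  -- The defining property of the walk concerns single histories. Finite histories form a countable
  -- set, so measures agreeing on singletons are equal; restricting to `L` fixes the current state
  -- and thereby the step probability.
  have heq : ((P.restrict F).map pre).restrict L =
      (ENNReal.ofReal (moveProb β k x m) • P.map pre).restrict L := by
    refine Measure.ext_of_singleton fun c => ?_
    rw [Measure.restrict_apply (measurableSet_singleton c),
      Measure.restrict_apply (measurableSet_singleton c)]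
    by_cases hc : c ∈ L
    · rw [Set.inter_eq_left.2 (Set.singleton_subset_iff.2 hc), Measure.smul_apply, smul_eq_mul,
        Measure.map_apply mpre (measurableSet_singleton c),
        Measure.map_apply mpre (measurableSet_singleton c),
        Measure.restrict_apply (mpre (measurableSet_singleton c))]
      -- The value 0 after time `t` is immaterial, since `history` looks only at times up to `t`.
      have hh := hS.measureReal_history t
        (fun s => if h : s < t + 1 then c ⟨s, h⟩ else 0) m
      have hx : (fun s => if h : s < t + 1 then c ⟨s, h⟩ else 0) t = x := by
        have : c (Fin.last t) = x := hc
        simpa [Fin.last] using this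
      have hset : history S (fun s => if h : s < t + 1 then c ⟨s, h⟩ else 0) t = pre ⁻¹' {c} := by
        ext ω
        simp only [history, Set.mem_ofPred_eq, Set.mem_preimage, Set.mem_singleton_iff, hpre]
        constructor
        · intro h
          funext s
          have hs := s.2
          have := h s (by omega)
          simpa [hs] using this
        · rintro rfl s hs
          simp [Nat.lt_succ_of_le hs]
      rw [hset] at hh
      simp only at hx
      rw [hx] at hh
      rw [← ENNReal.toReal_eq_toReal_iff' (measure_ne_top _ _)
        (ENNReal.mul_ne_top ENNReal.ofReal_ne_top (measure_ne_top _ _)), ENNReal.toReal_mul,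
        ENNReal.toReal_ofReal hρ, mul_comm]
      exact hh
    · have : {c} ∩ L = ∅ := by
        rw [Set.singleton_inter_eq_empty]; exact hc
      simp [this]
  have h1 := congrArg (fun μ => μ C) heq
  have mC : MeasurableSet C := MeasurableSet.of_discrete
  have mL : MeasurableSet L := MeasurableSet.of_discrete
  simp only [Measure.restrict_apply mC, Measure.smul_apply, smul_eq_mul,
    Measure.map_apply mpre (mC.inter mL), Measure.restrict_apply (mpre (mC.inter mL))] at h1
  have h2 := congrArg ENNReal.toReal h1
  rw [ENNReal.toReal_mul, ENNReal.toReal_ofReal hρ, mul_comm] at h2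
  exact h2

lemma IsWalk.measureReal_visit_step (hS : IsWalk (rate β k) P S) (hβ : ∀ i, 0 < β i)
    (hk : ∀ i, 0 < k i) (hR : ∀ x, exitRate β k x ≤ 1) (j t : ℕ) (x : Fin d → ℤ)
    (m : Option (Fin d × Bool)) :
    P.real (visit S j t x ∩ {ω | S (t + 1) ω = x + move m}) =
      P.real (visit S j t x) * moveProb β k x m := by
  have := hS.measureReal_step hβ hk hR t
    {c | jumpCount (fun s => if h : s < t + 1 then c ⟨s, h⟩ else 0) t = j} x m
  have e : ∀ ω, jumpCount (fun s => if h : s < t + 1 then S (⟨s, h⟩ : Fin (t + 1)) ω else 0) t =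
      jumpCount (fun s => S s ω) t := fun ω =>
    jumpCount_congr fun s hs => by simp [Nat.lt_succ_of_le hs]
  simp only [Set.mem_ofPred_eq, e] at this
  exact this

end Walk

lemma hasSum_measureReal_iUnion {ι Ω : Type*} [Countable ι] [MeasurableSpace Ω] {P : Measure Ω}
    [IsFiniteMeasure P] {A : ι → Set Ω} (hd : Pairwise (Function.onFun Disjoint A))
    (hm : ∀ i, MeasurableSet (A i)) : HasSum (fun i => P.real (A i)) (P.real (⋃ i, A i)) := by
  have h := measure_iUnion (μ := P) hd hm
  have hne : ∑' i, P (A i) ≠ ⊤ := h ▸ measure_ne_top P _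
  rw [measureReal_def, h, ENNReal.tsum_toReal_eq fun i => measure_ne_top P _]
  exact ENNReal.hasSum_toReal hne

/-- The points of norm `n`. -/
def sphere (d n : ℕ) : Finset (Fin d → ℤ) :=
  {x ∈ Fintype.piFinset fun _ => Finset.Icc (-(n : ℤ)) n | l1 x = n}

lemma mem_sphere {d n : ℕ} {x : Fin d → ℤ} : x ∈ sphere d n ↔ l1 x = n := by
  rw [sphere, Finset.mem_filter, and_iff_right_iff_imp]
  rintro rfl
  refine Fintype.mem_piFinset.2 fun i => Finset.mem_Icc.2 ?_
  have : (x i).natAbs ≤ l1 x :=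
    Finset.single_le_sum (f := fun i => (x i).natAbs) (fun _ _ => Nat.zero_le _) (Finset.mem_univ i)
  omega

/-- The probability of a step from `x` that increases the norm. -/
def upRate {d : ℕ} (β k : Fin d → ℝ) (x : Fin d → ℤ) : ℝ :=
  ∑ m with l1 (x + move m) = l1 x + 1, moveProb β k x m

/-- The probability that the norm is `n` after `j` jumps, in terms of the heat kernel. -/
def levelMass {d : ℕ} (β k : Fin d → ℝ) (j n : ℕ) : ℝ :=
  ∑ x ∈ sphere d n, weight k x * heat β k 0 j x * exitRate β k x

/-- The probability that the norm is `n` after `j` jumps and increases at the next jump, in terms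
of the heat kernel. -/
def levelUp {d : ℕ} (β k : Fin d → ℝ) (j n : ℕ) : ℝ :=
  ∑ x ∈ sphere d n, weight k x * heat β k 0 j x * upRate β k x

lemma eq_of_jumpCount {d : ℕ} {x : ℕ → Fin d → ℤ} {j t t' : ℕ} (h1 : jumpCount x t = j)
    (h2 : jumpCount x (t + 1) = j + 1) (h1' : jumpCount x t' = j)
    (h2' : jumpCount x (t' + 1) = j + 1) : t = t' := by
  by_contra hne
  rcases Nat.lt_or_gt_of_ne hne with h | h
  · have := monotone_jumpCount (x := x) (show t + 1 ≤ t' from h); omega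
  · have := monotone_jumpCount (x := x) (show t' + 1 ≤ t from h); omega

section

variable {d : ℕ} {β k : Fin d → ℝ} {Ω : Type*} {S : ℕ → Ω → Fin d → ℤ}

/-- The event that the `(j + 1)`-st jump of the walk is made from `x` by an increment in `M`. -/
def leave (S : ℕ → Ω → Fin d → ℤ) (j : ℕ) (x : Fin d → ℤ) (M : Finset (Option (Fin d × Bool))) :
    Set Ω :=
  ⋃ t, ⋃ m ∈ M, visit S j t x ∩ {ω | S (t + 1) ω = x + move m}

lemma mem_leave {j : ℕ} {x : Fin d → ℤ} {M : Finset (Option (Fin d × Bool))} {ω : Ω} :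
    ω ∈ leave S j x M ↔ ∃ t, (jumpCount (fun s => S s ω) t = j ∧ S t ω = x) ∧
      ∃ m ∈ M, S (t + 1) ω = x + move m := by
  simp only [leave, Set.mem_iUnion, Set.mem_inter_iff, visit, Set.mem_ofPred_eq, exists_prop]
  grind

lemma jumpCount_succ_of_move {t : ℕ} {x : Fin d → ℤ} {m : Option (Fin d × Bool)} {ω : Ω}
    (hx : S t ω = x) (hm : m ≠ none) (h : S (t + 1) ω = x + move m) :
    jumpCount (fun s => S s ω) (t + 1) = jumpCount (fun s => S s ω) t + 1 := by
  rw [jumpCount, if_neg]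
  rw [h, hx]
  exact l1_add_move_ne x hm

lemma disjoint_leave {j : ℕ} {x y : Fin d → ℤ} {M N : Finset (Option (Fin d × Bool))}
    (hM : none ∉ M) (hN : none ∉ N) (hxy : x ≠ y) : Disjoint (leave S j x M) (leave S j y N) := by
  refine Set.disjoint_left.2 fun ω h1 h2 => hxy ?_
  obtain ⟨t, ⟨ht, hx⟩, m, hm, hs⟩ := mem_leave.1 h1
  obtain ⟨t', ⟨ht', hx'⟩, m', hm', hs'⟩ := mem_leave.1 h2
  have e1 := jumpCount_succ_of_move hx (ne_of_mem_of_not_mem hm hM) hs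
  have e2 := jumpCount_succ_of_move hx' (ne_of_mem_of_not_mem hm' hN) hs'
  obtain rfl := eq_of_jumpCount ht (by omega) ht' (by omega)
  rw [← hx, ← hx']

variable [MeasurableSpace Ω] {P : Measure Ω}

lemma IsWalk.measurableSet_visit_step (hS : IsWalk (rate β k) P S) (j t : ℕ) (x y : Fin d → ℤ) :
    MeasurableSet (visit S j t x ∩ {ω | S (t + 1) ω = y}) :=
  (hS.measurableSet_visit j t x).inter (hS.measurable _ (measurableSet_singleton y))

lemma IsWalk.measurableSet_leave (hS : IsWalk (rate β k) P S) (j : ℕ) (x : Fin d → ℤ)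
    (M : Finset (Option (Fin d × Bool))) : MeasurableSet (leave S j x M) :=
  MeasurableSet.iUnion fun t => Finset.measurableSet_biUnion _ fun _ _ =>
    hS.measurableSet_visit_step j t x _

variable [IsProbabilityMeasure P]

lemma IsWalk.measureReal_visit_moves (hS : IsWalk (rate β k) P S) (hβ : ∀ i, 0 < β i)
    (hk : ∀ i, 0 < k i) (hR : ∀ x, exitRate β k x ≤ 1) (j t : ℕ) (x : Fin d → ℤ)
    (M : Finset (Option (Fin d × Bool))) :
    P.real (⋃ m ∈ M, visit S j t x ∩ {ω | S (t + 1) ω = x + move m}) =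
      P.real (visit S j t x) * ∑ m ∈ M, moveProb β k x m := by
  rw [measureReal_biUnion_finset, Finset.mul_sum]
  · exact Finset.sum_congr rfl fun m _ => hS.measureReal_visit_step hβ hk hR j t x m
  · refine fun m _ m' _ hne => Set.disjoint_left.2 fun ω h1 h2 => hne (move_injective ?_)
    exact add_left_cancel (h1.2.symm.trans h2.2)
  · exact fun m _ => hS.measurableSet_visit_step j t x _

/-- Almost surely, the walk only makes the prescribed moves. -/
lemma IsWalk.ae_exists_move (hS : IsWalk (rate β k) P S) (hβ : ∀ i, 0 < β i)
    (hk : ∀ i, 0 < k i) (hR : ∀ x, exitRate β k x ≤ 1) :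
    ∀ᵐ ω ∂P, ∀ t, ∃ m, S (t + 1) ω = S t ω + move m := by
  refine ae_all_iff.2 fun t => ?_
  have key : ∀ j x, P (visit S j t x \
      ⋃ m ∈ Finset.univ, visit S j t x ∩ {ω | S (t + 1) ω = x + move m}) = 0 := fun j x => by
    have hsub : (⋃ m ∈ Finset.univ, visit S j t x ∩ {ω | S (t + 1) ω = x + move m}) ⊆
        visit S j t x := Set.iUnion₂_subset fun m _ => Set.inter_subset_left
    rw [← measureReal_eq_zero_iff, measureReal_sdiff hsub
      (Finset.measurableSet_biUnion _ fun _ _ => hS.measurableSet_visit_step j t x _),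
      hS.measureReal_visit_moves hβ hk hR, sum_moveProb]
    ring
  have hnull : P (⋃ j, ⋃ x, visit S j t x \
      ⋃ m ∈ Finset.univ, visit S j t x ∩ {ω | S (t + 1) ω = x + move m}) = 0 :=
    measure_iUnion_null fun j => measure_iUnion_null fun x => key j x
  refine measure_mono_null (fun ω hω => ?_) hnull
  simp only [Set.mem_iUnion]
  refine ⟨jumpCount (fun s => S s ω) t, S t ω, ⟨rfl, rfl⟩, fun h => hω ?_⟩
  simp only [Set.mem_iUnion] at h
  obtain ⟨m, -, h⟩ := h
  exact ⟨m, h.2⟩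

lemma IsWalk.measureReal_visit_zero (hS : IsWalk (rate β k) P S) (j : ℕ) (x : Fin d → ℤ) :
    P.real (visit S j 0 x) = if j = 0 ∧ x = 0 then 1 else 0 := by
  split_ifs with h
  · obtain ⟨rfl, rfl⟩ := h
    have : visit S 0 0 0 ∈ ae P := hS.start.mono fun ω h => ⟨rfl, h⟩
    rw [measureReal_def, (mem_ae_iff_prob_eq_one (hS.measurableSet_visit 0 0 0)).1 this,
      ENNReal.toReal_one]
  · rw [measureReal_eq_zero_iff]
    refine measure_mono_null (fun ω hω => ?_) hS.start
    intro h0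
    exact h ⟨hω.1.symm, hω.2.symm.trans h0⟩

lemma IsWalk.measureReal_visit_zero_succ (hS : IsWalk (rate β k) P S) (hβ : ∀ i, 0 < β i)
    (hk : ∀ i, 0 < k i) (hR : ∀ x, exitRate β k x ≤ 1) (t : ℕ) (x : Fin d → ℤ) :
    P.real (visit S 0 (t + 1) x) = (1 - exitRate β k x) * P.real (visit S 0 t x) := by
  rw [mul_comm, show 1 - exitRate β k x = moveProb β k x none from rfl,
    ← hS.measureReal_visit_step hβ hk hR]
  refine measureReal_congr ((hS.ae_exists_move hβ hk hR).mono fun ω hω => propext ⟨?_, ?_⟩)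
  · rintro ⟨h1, h2⟩
    obtain ⟨m, hm⟩ := hω t
    by_cases hmn : m = none
    · subst hmn
      have h3 : S t ω = x := by rw [← h2, hm, move, add_zero]
      refine ⟨⟨?_, h3⟩, h2.trans (by rw [move, add_zero])⟩
      have := monotone_jumpCount (x := fun s => S s ω) (Nat.le_add_right t 1)
      omega
    · have := jumpCount_succ_of_move rfl hmn hm
      omega
  · rintro ⟨⟨h1, h2⟩, h3⟩
    replace h3 : S (t + 1) ω = x := h3.trans (by rw [move, add_zero])
    refine ⟨?_, h3⟩
    rw [jumpCount, if_pos (by rw [h3, h2]), h1]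

/-- Decomposition by the last step: a zero step at `x`, or a jump into `x` from a neighbour. -/
lemma IsWalk.measureReal_visit_succ_succ (hS : IsWalk (rate β k) P S) (hβ : ∀ i, 0 < β i)
    (hk : ∀ i, 0 < k i) (hR : ∀ x, exitRate β k x ≤ 1) (j t : ℕ) (x : Fin d → ℤ) :
    P.real (visit S (j + 1) (t + 1) x) = (1 - exitRate β k x) * P.real (visit S (j + 1) t x) +
      ∑ p : Fin d × Bool, P.real (visit S j t (x - move (some p))) *
        moveProb β k (x - move (some p)) (some p) := by
  rw [mul_comm (1 - _), show 1 - exitRate β k x = moveProb β k x none from rfl,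
    ← hS.measureReal_visit_step hβ hk hR]
  simp_rw [← hS.measureReal_visit_step hβ hk hR]
  rw [← measureReal_iUnion_fintype, ← measureReal_union]
  · refine measureReal_congr ((hS.ae_exists_move hβ hk hR).mono fun ω hω => propext ⟨?_, ?_⟩)
    · rintro ⟨h1, h2⟩
      obtain ⟨m, hm⟩ := hω t
      obtain _ | p := m
      · left
        have h3 : S t ω = x := by rw [← h2, hm, move, add_zero]
        refine ⟨⟨?_, h3⟩, h2.trans (by rw [move, add_zero])⟩
        rw [← h1]
        simp only [jumpCount]
        rw [if_pos (by rw [h2, h3]), add_zero]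
      · right
        have := jumpCount_succ_of_move rfl (Option.some_ne_none p) hm
        refine Set.mem_iUnion.2 ⟨p, ⟨by omega, ?_⟩, ?_⟩
        · rw [← h2, hm, add_sub_cancel_right]
        · exact h2.trans (sub_add_cancel x _).symm
    · rintro (⟨⟨h1, h2⟩, h3⟩ | h)
      · replace h3 : S (t + 1) ω = x := h3.trans (by rw [move, add_zero])
        refine ⟨?_, h3⟩
        rw [jumpCount, if_pos (by rw [h3, h2]), h1]
      · obtain ⟨p, ⟨h1, h2⟩, h3⟩ := Set.mem_iUnion.1 h
        have := jumpCount_succ_of_move h2 (Option.some_ne_none p) h3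
        exact ⟨by omega, h3.trans (sub_add_cancel x _)⟩
  · refine Set.disjoint_left.2 fun ω h1 h2 => ?_
    obtain ⟨p, h2⟩ := Set.mem_iUnion.1 h2
    have e1 := h1.1.1
    have e2 := h2.1.1
    omega
  · exact MeasurableSet.iUnion fun p => hS.measurableSet_visit_step _ _ _ _
  · refine fun p q hpq => Set.disjoint_left.2 fun ω h1 h2 => hpq ?_
    have := h1.1.2.symm.trans h2.1.2
    exact Option.some_injective _ (move_injective (sub_right_injective this))
  · exact fun p => hS.measurableSet_visit_step _ _ _ _

/-- The expected number of visits to `x` between the `j`-th jump and the next one. -/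
lemma IsWalk.hasSum_visit [NeZero d] (hS : IsWalk (rate β k) P S) (hβ : ∀ i, 0 < β i)
    (hk : ∀ i, 0 < k i) (hR : ∀ x, exitRate β k x ≤ 1) (j : ℕ) (x : Fin d → ℤ) :
    HasSum (fun t => P.real (visit S j t x)) (weight k x * heat β k 0 j x) := by
  induction j generalizing x with
  | zero =>
    have h := hasSum_of_linear_recursion (n := fun t => P.real (visit S 0 t x)) (s := fun _ => 0)
      (fun t => measureReal_nonneg) (fun _ => le_rfl) (exitRate_pos hβ hk x)
      (fun t => by rw [add_zero, hS.measureReal_visit_zero_succ hβ hk hR]) hasSum_zero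
    convert h using 1
    rw [hS.measureReal_visit_zero]
    by_cases hx : x = 0
    · subst hx
      have := (weight_pos hk (0 : Fin d → ℤ)).ne'
      have := (exitRate_pos hβ hk (0 : Fin d → ℤ)).ne'
      simp only [heat, Function.iterate_zero, id_eq, Pi.single_eq_same, and_self, if_true, add_zero]
      field_simp
    · simp [heat, hx]
  | succ j ih =>
    have hs := hasSum_sum (s := Finset.univ) fun (p : Fin d × Bool) _ =>
      (ih (x - move (some p))).mul_right (moveProb β k (x - move (some p)) (some p))
    have h := hasSum_of_linear_recursion (n := fun t => P.real (visit S (j + 1) t x))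
      (fun t => measureReal_nonneg) (fun t => Finset.sum_nonneg fun p _ =>
        mul_nonneg measureReal_nonneg (moveProb_nonneg hβ hk hR _ _)) (exitRate_pos hβ hk x)
      (fun t => hS.measureReal_visit_succ_succ hβ hk hR j t x) hs
    convert h using 1
    rw [hS.measureReal_visit_zero, if_neg (by simp), zero_add, eq_div_iff (exitRate_pos hβ hk x).ne',
      heat_succ, mul_assoc, mul_comm (jumpAvg _ _ _ _), exitRate_mul_jumpAvg hβ hk,
      Fintype.sum_prod_type, Finset.mul_sum]
    refine Finset.sum_congr rfl fun i _ => ?_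
    simp only [Fintype.sum_bool, move, moveProb, sub_neg_eq_add]
    -- Detailed balance replaces the conductances seen from the neighbours by those seen from `x`.
    linear_combination heat β k 0 j (x - Pi.single i 1) *
      (-weight_mul_rate_sub (β := β) hk x i 1) +
        heat β k 0 j (x + Pi.single i 1) * (-weight_mul_rate_add (β := β) hk x i 1)

/-- The jump with a given number happens at one time only, so the probabilities over `t` add up to
the expected number of visits times the step probability. -/
lemma IsWalk.measureReal_leave [NeZero d] (hS : IsWalk (rate β k) P S) (hβ : ∀ i, 0 < β i)
    (hk : ∀ i, 0 < k i) (hR : ∀ x, exitRate β k x ≤ 1) (j : ℕ) (x : Fin d → ℤ)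
    {M : Finset (Option (Fin d × Bool))} (hM : none ∉ M) :
    P.real (leave S j x M) = weight k x * heat β k 0 j x * ∑ m ∈ M, moveProb β k x m := by
  have h1 := (hS.hasSum_visit hβ hk hR j x).mul_right (∑ m ∈ M, moveProb β k x m)
  simp_rw [← hS.measureReal_visit_moves hβ hk hR] at h1
  refine (hasSum_measureReal_iUnion (fun t t' hne => ?_) fun t =>
    Finset.measurableSet_biUnion _ fun _ _ => hS.measurableSet_visit_step j t x _).unique h1
  refine Set.disjoint_left.2 fun ω h1 h2 => hne ?_
  simp only [Set.mem_iUnion, Set.mem_inter_iff] at h1 h2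
  obtain ⟨m, hm, ⟨ht, hx⟩, hs⟩ := h1
  obtain ⟨m', hm', ⟨ht', hx'⟩, hs'⟩ := h2
  have e1 := jumpCount_succ_of_move hx (ne_of_mem_of_not_mem hm hM) hs
  have e2 := jumpCount_succ_of_move hx' (ne_of_mem_of_not_mem hm' hM) hs'
  exact eq_of_jumpCount ht (by omega) ht' (by omega)

lemma sum_moveProb_erase (x : Fin d → ℤ) :
    ∑ m ∈ Finset.univ.erase none, moveProb β k x m = exitRate β k x := by
  have h := Finset.add_sum_erase Finset.univ (moveProb β k x) (Finset.mem_univ none)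
  rw [sum_moveProb] at h
  have h2 : moveProb β k x none = 1 - exitRate β k x := rfl
  linarith

/-- Almost surely, the walk makes infinitely many jumps. -/
lemma IsWalk.ae_exists_jump [NeZero d] (hS : IsWalk (rate β k) P S) (hβ : ∀ i, 0 < β i)
    (hk : ∀ i, 0 < k i) (hR : ∀ x, exitRate β k x ≤ 1) :
    ∀ᵐ ω ∂P, ∀ j, ∃ t, jumpCount (fun s => S s ω) t = j ∧
      jumpCount (fun s => S s ω) (t + 1) = j + 1 := by
  refine ae_all_iff.2 fun j => ?_
  have hn : none ∉ (Finset.univ.erase none : Finset (Option (Fin d × Bool))) :=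
    Finset.notMem_erase _ _
  have hm : ∀ x, MeasurableSet (leave S j x (Finset.univ.erase none)) := fun x =>
    hS.measurableSet_leave j x _
  have h1 := hasSum_measureReal_iUnion (P := P)
    (fun x y hxy => disjoint_leave (S := S) (j := j) hn hn hxy) hm
  -- The probability that another jump occurs is the total mass of the kernel, which the jump
  -- operator conserves.
  have h2 : P.real (⋃ x, leave S j x (Finset.univ.erase none)) = 1 := by
    rw [← h1.tsum_eq, ← pairing_heat_one hβ hk (0 : Fin d → ℤ) j, pairing]
    refine tsum_congr fun x => ?_
    rw [hS.measureReal_leave hβ hk hR j x hn, sum_moveProb_erase]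
    ring
  rw [measureReal_def, ENNReal.toReal_eq_one_iff,
    ← mem_ae_iff_prob_eq_one (MeasurableSet.iUnion hm)] at h2
  filter_upwards [h2] with ω hω
  obtain ⟨x, hx⟩ := Set.mem_iUnion.1 hω
  obtain ⟨t, ⟨ht, hxt⟩, m, hmm, hs⟩ := mem_leave.1 hx
  exact ⟨t, ht, by rw [jumpCount_succ_of_move hxt (Finset.ne_of_mem_erase hmm) hs, ht]⟩

lemma IsWalk.measureReal_sphere_leave (hS : IsWalk (rate β k) P S) (j n : ℕ)
    {M : (Fin d → ℤ) → Finset (Option (Fin d × Bool))} (hM : ∀ x, none ∉ M x) :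
    P.real (⋃ x ∈ sphere d n, leave S j x (M x)) =
      ∑ x ∈ sphere d n, P.real (leave S j x (M x)) :=
  measureReal_biUnion_finset (fun x _ y _ hxy => disjoint_leave (hM x) (hM y) hxy)
    fun x _ => hS.measurableSet_leave j x _

lemma IsWalk.activeNorm_ae_eq [NeZero d] (hS : IsWalk (rate β k) P S) (hβ : ∀ i, 0 < β i)
    (hk : ∀ i, 0 < k i) (hR : ∀ x, exitRate β k x ≤ 1) (j n : ℕ) :
    {ω | activeNorm S j ω = n} =ᵐ[P] ⋃ x ∈ sphere d n, leave S j x (Finset.univ.erase none) := by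
  filter_upwards [hS.ae_exists_jump hβ hk hR, hS.ae_exists_move hβ hk hR] with ω hj hm
  refine propext ⟨fun h => ?_, fun h => ?_⟩
  · obtain ⟨t, ht, ht'⟩ := hj j
    obtain ⟨m, hmt⟩ := hm t
    refine Set.mem_iUnion₂.2 ⟨S t ω, mem_sphere.2 ?_, mem_leave.2 ⟨t, ⟨ht, rfl⟩, m, ?_, hmt⟩⟩
    · exact (l1_eq_activeTime hj ht).trans h
    · refine Finset.mem_erase.2 ⟨?_, Finset.mem_univ _⟩
      rintro rfl
      rw [jumpCount, if_pos (by rw [hmt, move, add_zero])] at ht'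
      omega
  · obtain ⟨x, hx, h⟩ := Set.mem_iUnion₂.1 h
    obtain ⟨t, ⟨ht, rfl⟩, -⟩ := mem_leave.1 h
    exact (l1_eq_activeTime hj ht).symm.trans (mem_sphere.1 hx)

lemma IsWalk.activeNorm_succ_ae_eq [NeZero d] (hS : IsWalk (rate β k) P S) (hβ : ∀ i, 0 < β i)
    (hk : ∀ i, 0 < k i) (hR : ∀ x, exitRate β k x ≤ 1) (j n : ℕ) :
    ({ω | activeNorm S j ω = n} ∩ {ω | activeNorm S (j + 1) ω = n + 1} : Set Ω) =ᵐ[P]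
      ⋃ x ∈ sphere d n, leave S j x {m | l1 (x + move m) = l1 x + 1} := by
  filter_upwards [hS.ae_exists_jump hβ hk hR, hS.ae_exists_move hβ hk hR] with ω hj hm
  refine propext ⟨fun ⟨h1, h2⟩ => ?_, fun h => ?_⟩
  · obtain ⟨t, ht, ht'⟩ := hj j
    obtain ⟨m, hmt⟩ := hm t
    have e1 := (l1_eq_activeTime hj ht).trans h1
    have e2 := (l1_eq_activeTime hj ht').trans h2
    refine Set.mem_iUnion₂.2 ⟨S t ω, mem_sphere.2 e1, mem_leave.2 ⟨t, ⟨ht, rfl⟩, m, ?_, hmt⟩⟩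
    rw [Finset.mem_filter, ← hmt]
    exact ⟨Finset.mem_univ _, e2.trans (by rw [← e1])⟩
  · obtain ⟨x, hx, h⟩ := Set.mem_iUnion₂.1 h
    obtain ⟨t, ⟨ht, rfl⟩, m, hmm, hmt⟩ := mem_leave.1 h
    rw [Finset.mem_filter, ← hmt] at hmm
    have ht' : jumpCount (fun s => S s ω) (t + 1) = j + 1 := by
      rw [jumpCount, if_neg (by omega), ht]
    refine ⟨(l1_eq_activeTime hj ht).symm.trans (mem_sphere.1 hx), ?_⟩
    refine (l1_eq_activeTime hj ht').symm.trans ?_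
    rw [hmm.2, mem_sphere.1 hx]

lemma IsWalk.measureReal_activeNorm [NeZero d] (hS : IsWalk (rate β k) P S) (hβ : ∀ i, 0 < β i)
    (hk : ∀ i, 0 < k i) (hR : ∀ x, exitRate β k x ≤ 1) (j n : ℕ) :
    P.real {ω | activeNorm S j ω = n} = levelMass β k j n := by
  have hn : none ∉ (Finset.univ.erase none : Finset (Option (Fin d × Bool))) :=
    Finset.notMem_erase _ _
  rw [measureReal_congr (hS.activeNorm_ae_eq hβ hk hR j n),
    hS.measureReal_sphere_leave j n fun _ => hn]
  exact Finset.sum_congr rfl fun x _ => by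
    rw [hS.measureReal_leave hβ hk hR j x hn, sum_moveProb_erase]

lemma IsWalk.measureReal_activeNorm_succ [NeZero d] (hS : IsWalk (rate β k) P S)
    (hβ : ∀ i, 0 < β i) (hk : ∀ i, 0 < k i) (hR : ∀ x, exitRate β k x ≤ 1) (j n : ℕ) :
    P.real ({ω | activeNorm S j ω = n} ∩ {ω | activeNorm S (j + 1) ω = n + 1}) =
      levelUp β k j n := by
  have hn : ∀ x : Fin d → ℤ, none ∉ ({m | l1 (x + move m) = l1 x + 1} :
      Finset (Option (Fin d × Bool))) := fun x h => by
    have := (Finset.mem_filter.1 h).2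
    rw [move, add_zero] at this
    omega
  rw [measureReal_congr (hS.activeNorm_succ_ae_eq hβ hk hR j n),
    hS.measureReal_sphere_leave j n hn]
  exact Finset.sum_congr rfl fun x _ => hS.measureReal_leave hβ hk hR j x (hn x)

lemma IsWalk.upProb_eq [NeZero d] (hS : IsWalk (rate β k) P S)
    (hβ : ∀ i, 0 < β i) (hk : ∀ i, 0 < k i) (hR : ∀ x, exitRate β k x ≤ 1) (n j : ℕ) :
    upProb P S n j = levelUp β k j n / levelMass β k j n := by
  -- The event agrees almost surely with a measurable one, which suffices to evaluate the
  -- conditional measure.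
  have hnull : NullMeasurableSet {ω | activeNorm S j ω = n} P :=
    (Finset.measurableSet_biUnion _ fun x _ =>
      hS.measurableSet_leave j x (Finset.univ.erase none)).nullMeasurableSet.congr
        (hS.activeNorm_ae_eq hβ hk hR j n).symm
  rw [upProb, measureReal_def, ProbabilityTheory.cond, Measure.smul_apply,
    Measure.restrict_apply₀' hnull, smul_eq_mul,
    ENNReal.toReal_mul, ENNReal.toReal_inv, ← measureReal_def, ← measureReal_def, Set.inter_comm,
    hS.measureReal_activeNorm hβ hk hR, hS.measureReal_activeNorm_succ hβ hk hR]
  rw [div_eq_inv_mul]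

lemma exists_mem_sphere [NeZero d] (n : ℕ) : ∃ x, x ∈ sphere d n :=
  ⟨Pi.single 0 (n : ℤ), mem_sphere.2 (by
    have := l1_step (0 : Fin d → ℤ) 0 n
    simpa [l1] using this)⟩

/-- The limiting up-probabilities are averages over spheres for the reversible measure. -/
lemma IsWalk.hasLimitingUpProb [NeZero d] (hS : IsWalk (rate β k) P S)
    (hβ : ∀ i, 0 < β i) (hk : ∀ i, 0 < k i) (hR : ∀ x, exitRate β k x ≤ 1) (n : ℕ) :
    HasLimitingUpProb P S n ((∑ x ∈ sphere d n, weight k x * upRate β k x) /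
      ∑ x ∈ sphere d n, weight k x * exitRate β k x) := by
  have pos := heat_two_mul_pos hβ hk 0
  have nn := heat_nonneg hβ hk 0
  have wpos := weight_mul_exitRate_pos hβ hk
  have ne_iff : ∀ j, P {ω | activeNorm S j ω = n} ≠ 0 ↔ levelMass β k j n ≠ 0 := fun j => by
    rw [← hS.measureReal_activeNorm hβ hk hR, ne_eq, ne_eq, measureReal_eq_zero_iff]
  obtain ⟨x₀, hx₀⟩ := exists_mem_sphere (d := d) n
  refine ⟨?_, ?_⟩
  · rw [frequently_atTop]
    intro j₀
    obtain ⟨i, hi, hi'⟩ := (((tendsto_heat_add_div hβ hk x₀).eventually_const_lt one_pos).and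
      (eventually_ge_atTop j₀)).exists
    have hsum : 0 < heat β k 0 (2 * i) x₀ + heat β k 0 (2 * i + 1) x₀ := by
      by_contra! hle
      exact absurd hi (not_lt.2 (div_nonpos_of_nonpos_of_nonneg hle (pos i).le))
    obtain ⟨j, hj, hjpos⟩ : ∃ j ≥ j₀, 0 < heat β k 0 j x₀ := by
      by_cases h : 0 < heat β k 0 (2 * i) x₀
      · exact ⟨_, by omega, h⟩
      · exact ⟨2 * i + 1, by omega, by linarith⟩
    refine ⟨j, hj, (ne_iff j).2 (ne_of_gt (Finset.sum_pos' (fun x _ => ?_) ⟨x₀, hx₀, ?_⟩))⟩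
    · have := mul_nonneg (wpos x).le (nn j x); linarith
    · have := mul_pos (wpos x₀) hjpos; linarith
  · set H : ℕ → (Fin d → ℤ) → ℝ := fun j x =>
      (heat β k 0 (2 * j) x + heat β k 0 (2 * j + 1) x) / heat β k 0 (2 * j) 0 with hH
    have hlim : ∀ x, Tendsto (fun j => H (j / 2) x) atTop (𝓝 1) := fun x =>
      (tendsto_heat_add_div hβ hk x).comp (Nat.tendsto_div_const_atTop two_ne_zero)
    have hfrac : Tendsto (fun j => (∑ x ∈ sphere d n, weight k x * upRate β k x * H (j / 2) x) /
        ∑ x ∈ sphere d n, weight k x * exitRate β k x * H (j / 2) x) atTop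
        (𝓝 ((∑ x ∈ sphere d n, weight k x * upRate β k x) /
          ∑ x ∈ sphere d n, weight k x * exitRate β k x)) := by
      have t1 := tendsto_finsetSum (sphere d n) fun x _ =>
        (hlim x).const_mul (weight k x * upRate β k x)
      have t2 := tendsto_finsetSum (sphere d n) fun x _ =>
        (hlim x).const_mul (weight k x * exitRate β k x)
      simp only [mul_one] at t1 t2
      exact t1.div t2 (Finset.sum_pos (fun x _ => wpos x) ⟨x₀, hx₀⟩).ne'
    refine (hfrac.mono_left inf_le_left).congr' ?_
    refine (eventually_principal.2 fun j hj => ?_).filter_mono inf_le_right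
    rw [hS.upProb_eq hβ hk hR]
    obtain ⟨y, hy, hy0⟩ := Finset.exists_ne_zero_of_sum_ne_zero ((ne_iff j).1 hj)
    have hpar : (j + n) % 2 = 0 := by
      by_contra hodd
      refine hy0 ?_
      rw [heat_eq_zero_of_odd j y (by rw [mem_sphere.1 hy]; omega)]
      ring
    -- On this sphere one summand of `H` vanishes by parity, leaving the kernel after `j` jumps over
    -- a factor independent of `x`, which cancels in the quotient.
    have heq : ∀ x ∈ sphere d n, H (j / 2) x = heat β k 0 j x / heat β k 0 (2 * (j / 2)) 0 :=
      fun x hx => by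
        have hx := mem_sphere.1 hx
        simp only [hH]
        congr 1
        rcases Nat.even_or_odd' j with ⟨i, rfl | rfl⟩
        · rw [show 2 * i / 2 = i by omega, heat_eq_zero_of_odd (2 * i + 1) x (by omega), add_zero]
        · rw [show (2 * i + 1) / 2 = i by omega, heat_eq_zero_of_odd (2 * i) x (by omega), zero_add]
    have e1 : ∀ c : (Fin d → ℤ) → ℝ, ∑ x ∈ sphere d n, weight k x * c x * H (j / 2) x =
        (∑ x ∈ sphere d n, weight k x * heat β k 0 j x * c x) / heat β k 0 (2 * (j / 2)) 0 :=
      fun c => by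
        rw [Finset.sum_div]
        exact Finset.sum_congr rfl fun x hx => by rw [heq x hx]; ring
    beta_reduce
    rw [e1, e1, div_div_div_cancel_right₀ (pos _).ne', levelUp, levelMass]

end

/-! ### Log-concave sequences and monotonicity of subset sums. -/

/-- A nonnegative sequence that is log-concave in the form without internal zeros. -/
def IsLogConcave (c : ℕ → ℝ) : Prop :=
  (∀ m, 0 ≤ c m) ∧ ∀ i j, i ≤ j → c i * c (j + 2) ≤ c (i + 1) * c (j + 1)

/-- The sums over subsets `∑ c (|s| + p) ∏_{i ∈ s} k i`, as a sequence in `p`. -/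
def subsetSum {ι : Type*} (c : ℕ → ℝ) (k : ι → ℝ) (t : Finset ι) (p : ℕ) : ℝ :=
  ∑ s ∈ t.powerset, c (s.card + p) * ∏ i ∈ s, k i

lemma IsLogConcave.add_mul_shift {c : ℕ → ℝ} (h : IsLogConcave c) {κ : ℝ} (hκ : 0 ≤ κ) :
    IsLogConcave fun p => c p + κ * c (p + 1) := by
  obtain ⟨h0, h1⟩ := h
  refine ⟨fun m => add_nonneg (h0 _) (mul_nonneg hκ (h0 _)), fun i j hij => ?_⟩
  have e1 := h1 i j hij
  have e2 := h1 (i + 1) (j + 1) (by omega)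
  -- This compares the terms linear in `κ`; their common part `c (i + 1) * c (j + 2)` occurs on both
  -- sides.
  have e3 : c i * c (j + 3) ≤ c (i + 2) * c (j + 1) := by
    have e4 := h1 i (j + 1) (by omega)
    rcases hij.eq_or_lt with rfl | hlt
    · rwa [mul_comm (c (i + 2))]
    · exact e4.trans (h1 (i + 1) j hlt)
  simp only [add_assoc, Nat.reduceAdd] at *
  have e2' := mul_le_mul_of_nonneg_left e2 (mul_nonneg hκ hκ)
  have e3' := mul_le_mul_of_nonneg_left e3 hκ
  linarith

section

variable {ι : Type*} {c : ℕ → ℝ} {k : ι → ℝ}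

lemma subsetSum_one_pos (hc : IsLogConcave c) (hc1 : 0 < c 1) (hk : ∀ i, 0 < k i) (t : Finset ι) :
    0 < subsetSum c k t 1 := by
  refine Finset.sum_pos' (fun s _ => mul_nonneg (hc.1 _) (Finset.prod_nonneg fun i _ => (hk i).le))
    ⟨∅, Finset.empty_mem_powerset t, ?_⟩
  simpa using hc1

lemma subsetSum_congr {k' : ι → ℝ} {t : Finset ι} (h : ∀ i ∈ t, k i = k' i) (p : ℕ) :
    subsetSum c k t p = subsetSum c k' t p :=
  Finset.sum_congr rfl fun s hs => by
    rw [Finset.prod_congr rfl fun i hi => h i (Finset.mem_powerset.1 hs hi)]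

variable [DecidableEq ι]

lemma subsetSum_insert (c : ℕ → ℝ) (k : ι → ℝ) {t : Finset ι} {i : ι} (hi : i ∉ t) (p : ℕ) :
    subsetSum c k (insert i t) p = subsetSum c k t p + k i * subsetSum c k t (p + 1) := by
  rw [subsetSum, Finset.sum_powerset_insert hi, subsetSum, subsetSum, Finset.mul_sum]
  congr 1
  refine Finset.sum_congr rfl fun s hs => ?_
  have his : i ∉ s := fun h => hi (Finset.mem_powerset.1 hs h)
  rw [Finset.card_insert_of_notMem his, Finset.prod_insert his, add_assoc, add_comm 1 p]
  ring

lemma IsLogConcave.subsetSum (hc : IsLogConcave c) (hk : ∀ i, 0 < k i) (t : Finset ι) :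
    IsLogConcave (SemiWalk.subsetSum c k t) := by
  induction t using Finset.induction_on with
  | empty => simpa [SemiWalk.subsetSum, IsLogConcave] using hc
  | insert i t hi ih =>
    rw [funext (subsetSum_insert c k hi)]
    exact ih.add_mul_shift (hk i).le

lemma IsLogConcave.subsetSum_strict (hc : IsLogConcave c) (hc' : c 0 * c 2 < c 1 * c 1)
    (hk : ∀ i, 0 < k i) (t : Finset ι) :
    SemiWalk.subsetSum c k t 0 * SemiWalk.subsetSum c k t 2 <
      SemiWalk.subsetSum c k t 1 * SemiWalk.subsetSum c k t 1 := by
  induction t using Finset.induction_on with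
  | empty => simpa [SemiWalk.subsetSum] using hc'
  | insert i t hi ih =>
    obtain ⟨h0, h1⟩ := hc.subsetSum hk t
    have e1 := mul_le_mul_of_nonneg_left (h1 0 1 zero_le_one) (hk i).le
    have e2 := mul_le_mul_of_nonneg_left (h1 1 1 le_rfl) (mul_nonneg (hk i).le (hk i).le)
    simp only [subsetSum_insert c k hi, Nat.reduceAdd, zero_add] at *
    linarith

lemma subsetSum_update_of_notMem {t : Finset ι} {i : ι} (hi : i ∉ t) (v : ℝ) (p : ℕ) :
    subsetSum c (Function.update k i v) t p = subsetSum c k t p :=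
  subsetSum_congr (fun _ hl => Function.update_of_ne (ne_of_mem_of_not_mem hl hi) _ _) p

lemma update_pos (hk : ∀ i, 0 < k i) {i : ι} {v : ℝ} (hv : 0 < v) (l : ι) :
    0 < Function.update k i v l := by
  by_cases h : l = i
  · subst h; simpa
  · simpa [h] using hk l

/-- Quotients of neighbouring subset sums of a log-concave sequence increase in each variable. -/
lemma subsetSum_ratio_le_update (hc : IsLogConcave c) (hc1 : 0 < c 1) (hk : ∀ i, 0 < k i)
    (t : Finset ι) {i : ι} {v : ℝ} (hv : k i ≤ v) :
    subsetSum c k t 0 / subsetSum c k t 1 ≤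
      subsetSum c (Function.update k i v) t 0 / subsetSum c (Function.update k i v) t 1 := by
  by_cases hi : i ∈ t
  · have hv0 := (hk i).trans_le hv
    rw [div_le_div_iff₀ (subsetSum_one_pos hc hc1 hk t)
      (subsetSum_one_pos hc hc1 (update_pos hk hv0) t), ← Finset.insert_erase hi]
    have hn := Finset.notMem_erase i t
    simp only [subsetSum_insert _ _ hn, subsetSum_update_of_notMem hn, Function.update_self]
    -- With `A p` the subset sum without `i`, the ratio is `(A 0 + k i * A 1) / (A 1 + k i * A 2)`.
    -- Cross-multiplication leaves `(v - k i) * (A 1 ^ 2 - A 0 * A 2) ≥ 0`.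
    have := mul_le_mul_of_nonneg_left ((hc.subsetSum hk (t.erase i)).2 0 0 le_rfl)
      (sub_nonneg.2 hv)
    simp only [Nat.reduceAdd, zero_add] at *
    linarith
  · rw [subsetSum_update_of_notMem hi, subsetSum_update_of_notMem hi]

lemma subsetSum_ratio_lt_update (hc : IsLogConcave c) (hc1 : 0 < c 1)
    (hc' : c 0 * c 2 < c 1 * c 1) (hk : ∀ i, 0 < k i)
    {t : Finset ι} {i : ι} (hi : i ∈ t) {v : ℝ} (hv : k i < v) :
    subsetSum c k t 0 / subsetSum c k t 1 <
      subsetSum c (Function.update k i v) t 0 / subsetSum c (Function.update k i v) t 1 := by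
  have hv0 := (hk i).trans hv
  rw [div_lt_div_iff₀ (subsetSum_one_pos hc hc1 hk t)
    (subsetSum_one_pos hc hc1 (update_pos hk hv0) t), ← Finset.insert_erase hi]
  have hn := Finset.notMem_erase i t
  simp only [subsetSum_insert _ _ hn, subsetSum_update_of_notMem hn, Function.update_self]
  have := mul_lt_mul_of_pos_left (hc.subsetSum_strict hc' hk (t.erase i)) (sub_pos.2 hv)
  simp only [Nat.reduceAdd, zero_add] at *
  linarith

lemma subsetSum_ratio_mono [Fintype ι] (hc : IsLogConcave c) (hc1 : 0 < c 1) {k' : ι → ℝ}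
    (hk : ∀ i, 0 < k i) (hkk' : ∀ i, k i ≤ k' i) (t : Finset ι) :
    subsetSum c k t 0 / subsetSum c k t 1 ≤ subsetSum c k' t 0 / subsetSum c k' t 1 := by
  -- Pass from `k` to `k'` one coordinate at a time.
  have key : ∀ s : Finset ι, subsetSum c k t 0 / subsetSum c k t 1 ≤
      subsetSum c (s.piecewise k' k) t 0 / subsetSum c (s.piecewise k' k) t 1 := fun s => by
    induction s using Finset.induction_on with
    | empty => rw [Finset.piecewise_empty]
    | insert i s hi ih =>
      rw [Finset.piecewise_insert]
      refine ih.trans (subsetSum_ratio_le_update hc hc1 (fun l => ?_) t ?_)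
      · rw [Finset.piecewise]; split_ifs
        exacts [(hk l).trans_le (hkk' l), hk l]
      · rw [Finset.piecewise_eq_of_notMem _ _ _ hi]; exact hkk' i
  simpa using key Finset.univ

lemma subsetSum_ratio_strictMono [Fintype ι] (hc : IsLogConcave c) (hc1 : 0 < c 1)
    (hc' : c 0 * c 2 < c 1 * c 1) {k' : ι → ℝ} (hk : ∀ i, 0 < k i) (hkk' : ∀ i, k i < k' i)
    {t : Finset ι} (ht : t.Nonempty) :
    subsetSum c k t 0 / subsetSum c k t 1 < subsetSum c k' t 0 / subsetSum c k' t 1 := by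
  obtain ⟨i, hi⟩ := ht
  refine (subsetSum_ratio_lt_update hc hc1 hc' hk hi (hkk' i)).trans_le
    (subsetSum_ratio_mono hc hc1 (update_pos hk ((hk i).trans (hkk' i))) (fun l => ?_) t)
  by_cases h : l = i
  · subst h; simp
  · simpa [h] using (hkk' l).le

end

/-! ### Counting points of a sphere by support. -/

/-- The number of points of norm `n ≥ 1` whose support is a given set with `m` elements. -/
def levelCount (n m : ℕ) : ℕ := if m = 0 then 0 else 2 ^ m * (n - 1).choose (m - 1)

/-- The successive ratios `(N - p) / (p + 1)` of binomial coefficients decrease in `p`. -/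
lemma choose_mul_choose_le (N : ℕ) {p q : ℕ} (h : p ≤ q) :
    N.choose p * N.choose (q + 2) ≤ N.choose (p + 1) * N.choose (q + 1) := by
  have e1 := Nat.choose_succ_right_eq N p
  have e2 := Nat.choose_succ_right_eq N (q + 1)
  have e3 : (N - (q + 1)) * (p + 1) ≤ (N - p) * (q + 2) := Nat.mul_le_mul (by omega) (by omega)
  refine Nat.le_of_mul_le_mul_right (c := (p + 1) * (q + 2)) ?_ (by positivity)
  calc _ = N.choose p * (N.choose (q + 1 + 1) * (q + 1 + 1)) * (p + 1) := by ring
    _ = N.choose p * N.choose (q + 1) * ((N - (q + 1)) * (p + 1)) := by rw [e2]; ring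
    _ ≤ N.choose p * N.choose (q + 1) * ((N - p) * (q + 2)) := Nat.mul_le_mul_left _ e3
    _ = (N.choose p * (N - p)) * N.choose (q + 1) * (q + 2) := by ring
    _ = _ := by rw [← e1]; ring

lemma isLogConcave_levelCount (n : ℕ) : IsLogConcave fun m => (levelCount n m : ℝ) := by
  refine ⟨fun m => Nat.cast_nonneg _, fun i j hij => ?_⟩
  beta_reduce
  norm_cast
  rcases i with _ | p
  · rw [show levelCount n 0 = 0 from rfl, zero_mul]; exact Nat.zero_le _
  · obtain ⟨q, rfl⟩ : ∃ q, j = q + 1 := ⟨j - 1, by omega⟩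
    have := Nat.mul_le_mul_left (2 ^ (p + q + 4))
      (choose_mul_choose_le (n - 1) (Nat.le_of_succ_le_succ hij))
    have e : ∀ m, levelCount n (m + 1) = 2 ^ (m + 1) * (n - 1).choose m := fun m => rfl
    rw [e, e, e, show q + 1 + 2 = (q + 2) + 1 by ring, e]
    calc _ = 2 ^ (p + q + 4) * ((n - 1).choose p * (n - 1).choose (q + 2)) := by ring
      _ ≤ _ := this
      _ = _ := by ring

lemma levelCount_zero (n : ℕ) : levelCount n 0 = 0 := rfl

lemma levelCount_one (n : ℕ) : levelCount n 1 = 2 := by simp [levelCount]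

/-- The support of a point. -/
def support {d : ℕ} (x : Fin d → ℤ) : Finset (Fin d) := {i | x i ≠ 0}

/-- Subtracting 1 from every part turns compositions into positive parts into weak compositions of
`n - s.card`. -/
lemma card_piAntidiag_support {d : ℕ} (n : ℕ) (s : Finset (Fin d)) (hs : s.Nonempty) (hn : 1 ≤ n) :
    (Finset.card {a ∈ Finset.piAntidiag Finset.univ n | ∀ i, a i ≠ 0 ↔ i ∈ s}) =
      (n - 1).choose (s.card - 1) := by
  have hc := hs.card_pos
  have key : ∀ a : Fin d → ℕ, (∀ i, a i ≠ 0 ↔ i ∈ s) → ∑ i, a i = ∑ i ∈ s, (a i - 1) + s.card := by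
    intro a ha
    rw [← Finset.sum_subset (Finset.subset_univ s) fun i _ hi => by
      by_contra h; exact hi ((ha i).1 h), Finset.card_eq_sum_ones, ← Finset.sum_add_distrib]
    exact Finset.sum_congr rfl fun i hi => by have := (ha i).2 hi; omega
  by_cases hsn : s.card ≤ n
  · have : (Finset.card {a ∈ Finset.piAntidiag Finset.univ n | ∀ i, a i ≠ 0 ↔ i ∈ s}) =
        (Finset.piAntidiag s (n - s.card)).card := by
      refine Finset.card_bij' (fun a _ i => a i - 1) (fun a _ i => if i ∈ s then a i + 1 else 0)
        (fun a ha => ?_) (fun a ha => ?_) (fun a ha => ?_) (fun a ha => ?_)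
      · obtain ⟨h1, h2⟩ := Finset.mem_filter.1 ha
        have h3 := (Finset.mem_piAntidiag.1 h1).1
        rw [key a h2] at h3
        refine Finset.mem_piAntidiag.2 ⟨by omega, fun i hi => (h2 i).1 fun h => hi (by simp [h])⟩
      · obtain ⟨h1, h2⟩ := Finset.mem_piAntidiag.1 ha
        have h3 : ∀ i, (if i ∈ s then a i + 1 else 0) ≠ 0 ↔ i ∈ s := fun i => by
          split_ifs with h <;> simp [h]
        refine Finset.mem_filter.2 ⟨Finset.mem_piAntidiag.2 ⟨?_, fun i _ => Finset.mem_univ i⟩, h3⟩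
        rw [key _ h3, Finset.sum_congr rfl (g := a) fun i hi => by simp [hi], h1]
        omega
      · obtain ⟨h1, h2⟩ := Finset.mem_filter.1 ha
        funext i
        have := h2 i
        simp only
        split_ifs with h
        · have := this.2 h; omega
        · by_contra h'; exact h (this.1 (Ne.symm h'))
      · obtain ⟨h1, h2⟩ := Finset.mem_piAntidiag.1 ha
        funext i
        simp only
        split_ifs with h
        · rfl
        · by_contra h'; exact h (h2 i (Ne.symm h'))
    have hcard := Finset.card_finsuppAntidiag_nat_eq_choose (s := s) (n - s.card)
    rw [Finset.finsuppAntidiag, Finset.card_map, Finset.card_attach] at hcard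
    rw [this, hcard, show s.card + (n - s.card) - 1 = n - 1 by omega]
    exact Nat.choose_symm_of_eq_add (by omega)
  · rw [Nat.choose_eq_zero_of_lt (by omega), Finset.card_eq_zero, Finset.filter_eq_empty_iff]
    intro a ha h2
    have h3 := (Finset.mem_piAntidiag.1 ha).1
    rw [key a h2] at h3
    omega

/-- Fibre over the absolute values: each fibre consists of the `2 ^ s.card` choices of signs. -/
lemma card_sphere_support {d : ℕ} {n : ℕ} (hn : 1 ≤ n) (s : Finset (Fin d)) :
    (Finset.card {x ∈ sphere d n | support x = s}) = levelCount n s.card := by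
  rcases s.eq_empty_or_nonempty with rfl | hs
  · rw [Finset.card_empty, levelCount_zero, Finset.card_eq_zero, Finset.filter_eq_empty_iff]
    intro x hx h
    have hx := mem_sphere.1 hx
    have : ∀ i, x i = 0 := fun i => by
      by_contra hi
      have : i ∈ support x := Finset.mem_filter.2 ⟨Finset.mem_univ i, hi⟩
      rw [h] at this; exact absurd this (Finset.notMem_empty i)
    simp [l1, this] at hx
    omega
  · rw [levelCount, if_neg hs.card_pos.ne', ← card_piAntidiag_support n s hs hn,
      Finset.card_eq_sum_card_fiberwise (f := fun x i => (x i).natAbs)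
        (t := {a ∈ Finset.piAntidiag Finset.univ n | ∀ i, a i ≠ 0 ↔ i ∈ s}),
      Finset.sum_const_nat (m := 2 ^ s.card), mul_comm]
    · intro a ha
      obtain ⟨h1, h2⟩ := Finset.mem_filter.1 ha
      have h3 := (Finset.mem_piAntidiag.1 h1).1
      have : {x ∈ {x ∈ sphere d n | support x = s} | (fun i => (x i).natAbs) = a} =
          Fintype.piFinset fun i => ({(a i : ℤ), -(a i : ℤ)} : Finset ℤ) := by
        ext x
        simp only [Finset.mem_filter, Fintype.mem_piFinset, Finset.mem_insert,
          Finset.mem_singleton, mem_sphere]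
        constructor
        · rintro ⟨-, rfl⟩ i
          simp only; omega
        · intro h
          have ha : (fun i => (x i).natAbs) = a := funext fun i => by have := h i; omega
          refine ⟨⟨?_, ?_⟩, ha⟩
          · rw [← h3, ← ha]; rfl
          · ext i
            rw [support, Finset.mem_filter, ← h2 i, ← ha]
            simp
      rw [this, Fintype.card_piFinset, ← Finset.prod_subset (Finset.subset_univ s),
        Finset.prod_congr rfl (g := fun _ => 2), Finset.prod_const]
      · intro i hi
        have := (h2 i).2 hi
        exact Finset.card_pair (by omega)
      · intro i _ hi
        have : a i = 0 := by by_contra h; exact hi ((h2 i).1 h)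
        simp [this]
    · intro x hx
      obtain ⟨h1, h2⟩ := Finset.mem_filter.1 (Finset.mem_coe.1 hx)
      refine Finset.mem_coe.2 (Finset.mem_filter.2 ⟨Finset.mem_piAntidiag.2
        ⟨mem_sphere.1 h1, fun i _ => Finset.mem_univ i⟩, fun i => ?_⟩)
      rw [← h2, support, Finset.mem_filter]
      simp

lemma sum_sphere_support {d n : ℕ} (hn : 1 ≤ n) (f : Finset (Fin d) → ℝ) :
    ∑ x ∈ sphere d n, f (support x) = ∑ s, levelCount n s.card * f s := by
  rw [← Finset.sum_fiberwise (sphere d n) support]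
  refine Finset.sum_congr rfl fun s _ => ?_
  rw [← card_sphere_support hn, ← nsmul_eq_mul, ← Finset.sum_const]
  exact Finset.sum_congr rfl fun x hx => by rw [(Finset.mem_filter.1 hx).2]

section

variable {d : ℕ} {β k : Fin d → ℝ}

/-- At a zero coordinate both steps raise the norm, at a nonzero one just one of them does. -/
lemma upRate_eq (x : Fin d → ℤ) : upRate β k x =
    ∑ i, rate β k x i * (if x i = 0 then 2 else 1) := by
  have hn : ¬ l1 (x + move none) = l1 x + 1 := by rw [move, add_zero]; omega
  rw [upRate, Finset.sum_filter, Fintype.sum_option, if_neg hn, zero_add, Fintype.sum_prod_type]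
  refine Finset.sum_congr rfl fun i _ => ?_
  have h1 := l1_add_single x i
  have h2 := l1_sub_single x i
  rw [Fintype.sum_bool, move, move, ← sub_eq_add_neg]
  simp only [moveProb]
  split_ifs <;> first | omega | ring1

lemma weight_eq_prod_support (x : Fin d → ℤ) : weight k x = ∏ i ∈ support x, k i := by
  rw [weight, support, Finset.prod_filter]
  exact Finset.prod_congr rfl fun i _ => by split_ifs <;> simp_all

lemma rate_eq_support (x : Fin d → ℤ) (i : Fin d) :
    rate β k x i = if i ∈ support x then β i / k i else β i := by
  simp only [rate, support, Finset.mem_filter, Finset.mem_univ, true_and]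
  split_ifs <;> simp_all

/-- The rate of moving away from the hyperplanes, averaged over the sphere. -/
def offAxisSum (β k : Fin d → ℝ) (n : ℕ) : ℝ :=
  ∑ i, β i * subsetSum (fun m => (levelCount n m : ℝ)) k (Finset.univ.erase i) 0

/-- Half the rate of moving along the nonzero coordinates, averaged over the sphere. -/
def onAxisSum (β k : Fin d → ℝ) (n : ℕ) : ℝ :=
  ∑ i, β i * subsetSum (fun m => (levelCount n m : ℝ)) k (Finset.univ.erase i) 1

/-- For fixed `i`, split supports by whether they contain `i`. If they do, `k i` cancels against `β
i / k i` and the cardinality shifts by one; this is why index 1 appears in `onAxisSum`. -/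
lemma sum_subsets_rate (hk : ∀ i, 0 < k i) (n : ℕ) (u v : ℝ) :
    ∑ s : Finset (Fin d), levelCount n s.card *
      ((∏ i ∈ s, k i) * ∑ i, (if i ∈ s then u * (β i / k i) else v * β i)) =
      u * onAxisSum β k n + v * offAxisSum β k n := by
  simp_rw [Finset.mul_sum]
  rw [Finset.sum_comm, onAxisSum, offAxisSum, Finset.mul_sum, Finset.mul_sum,
    ← Finset.sum_add_distrib]
  refine Finset.sum_congr rfl fun i _ => ?_
  have hn := Finset.notMem_erase i (Finset.univ : Finset (Fin d))
  rw [← Finset.powerset_univ, ← Finset.insert_erase (Finset.mem_univ i),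
    Finset.sum_powerset_insert hn, Finset.insert_erase (Finset.mem_univ i), add_comm]
  simp only [subsetSum, Finset.mul_sum]
  congr 1
  · refine Finset.sum_congr rfl fun s hs => ?_
    have his : i ∉ s := fun h => hn (Finset.mem_powerset.1 hs h)
    have := (hk i).ne'
    rw [Finset.card_insert_of_notMem his, Finset.prod_insert his,
      if_pos (Finset.mem_insert_self i s)]
    field_simp
  · refine Finset.sum_congr rfl fun s hs => ?_
    have his : i ∉ s := fun h => hn (Finset.mem_powerset.1 hs h)
    rw [if_neg his, add_zero]
    ring

lemma sum_sphere_upRate (hk : ∀ i, 0 < k i) {n : ℕ} (hn : 1 ≤ n) :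
    ∑ x ∈ sphere d n, weight k x * upRate β k x = onAxisSum β k n + 2 * offAxisSum β k n := by
  rw [← one_mul (onAxisSum β k n), ← sum_subsets_rate hk, ← sum_sphere_support hn]
  refine Finset.sum_congr rfl fun x _ => ?_
  rw [weight_eq_prod_support, upRate_eq]
  congr 1
  refine Finset.sum_congr rfl fun i _ => ?_
  rw [rate_eq_support]
  simp only [support, Finset.mem_filter, Finset.mem_univ, true_and]
  split_ifs <;> first | ring1 | simp_all

lemma sum_sphere_exitRate (hk : ∀ i, 0 < k i) {n : ℕ} (hn : 1 ≤ n) :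
    ∑ x ∈ sphere d n, weight k x * exitRate β k x =
      2 * onAxisSum β k n + 2 * offAxisSum β k n := by
  rw [← sum_subsets_rate hk, ← sum_sphere_support hn]
  refine Finset.sum_congr rfl fun x _ => ?_
  rw [weight_eq_prod_support, exitRate, Finset.mul_sum]
  congr 1
  refine Finset.sum_congr rfl fun i _ => ?_
  rw [rate_eq_support]
  split_ifs <;> rfl

end

/-! ### The explicit formulas as subset sums. -/

section Explicit

lemma sum_Icc_one (f : ℕ → ℝ) (d : ℕ) :
    ∑ i ∈ Finset.Icc 1 d, f i = ∑ m ∈ Finset.range d, f (m + 1) := by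
  induction d with
  | zero => simp
  | succ d ih => rw [Finset.sum_Icc_succ_top (by omega), ih, Finset.sum_range_succ]

lemma subsetSum_const {ι : Type*} (c : ℕ → ℝ) (κ : ℝ) (t : Finset ι) (p : ℕ) :
    subsetSum c (fun _ => κ) t p =
      ∑ m ∈ Finset.range (t.card + 1), t.card.choose m * (c (m + p) * κ ^ m) := by
  rw [subsetSum]
  simp only [Finset.prod_const]
  rw [Finset.sum_powerset_apply_card (fun m => c (m + p) * κ ^ m)]
  simp

/-- Uses `(d - i) * C(d, i) = d * C(d - 1, i)`; the missing term `i = 0` vanishes because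
`levelCount n 0 = 0`. -/
lemma birth_sum_eq {ι : Type*} {t : Finset ι} {d : ℕ} (ht : t.card + 1 = d) (n : ℕ) (κ : ℝ) :
    ∑ i ∈ Finset.Icc 1 (d - 1),
        ((d : ℝ) - i) * (2 * κ) ^ i * d.choose i * (n - 1).choose (i - 1) =
      d * subsetSum (fun m => (levelCount n m : ℝ)) (fun _ => κ) t 0 := by
  subst ht
  rw [subsetSum_const, Finset.sum_range_succ', Nat.add_sub_cancel, sum_Icc_one]
  simp only [add_zero, levelCount_zero, Nat.cast_zero, zero_mul, mul_zero]
  rw [Finset.mul_sum]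
  refine Finset.sum_congr rfl fun m hm => ?_
  have hm := Finset.mem_range.1 hm
  have h1 := Nat.choose_mul_succ_eq t.card (m + 1)
  have h2 : ((t.card.choose (m + 1) : ℕ) : ℝ) * (t.card + 1) =
      (t.card + 1).choose (m + 1) * ((t.card + 1 : ℕ) - (m + 1 : ℕ)) := by
    rw [← Nat.cast_sub (by omega)]; exact_mod_cast h1
  rw [show levelCount n (m + 1) = 2 ^ (m + 1) * (n - 1).choose m from rfl, Nat.add_sub_cancel]
  push_cast at h2 ⊢
  rw [mul_pow]
  linear_combination (-(2 : ℝ) ^ (m + 1) * κ ^ (m + 1) * (n - 1).choose m) * h2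

/-- Uses `i * C(d, i) = d * C(d - 1, i - 1)`. -/
lemma death_sum_eq {ι : Type*} {t : Finset ι} {d : ℕ} (ht : t.card + 1 = d) (n : ℕ) (κ : ℝ) :
    ∑ i ∈ Finset.Icc 1 d, (i : ℝ) * (2 * κ) ^ i * d.choose i * (n - 1).choose (i - 1) =
      d * κ * subsetSum (fun m => (levelCount n m : ℝ)) (fun _ => κ) t 1 := by
  subst ht
  rw [subsetSum_const, sum_Icc_one, Finset.mul_sum]
  refine Finset.sum_congr rfl fun m _ => ?_
  have h1 := Nat.add_one_mul_choose_eq t.card m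
  have h2 : ((t.card : ℝ) + 1) * t.card.choose m = (t.card + 1).choose (m + 1) * (m + 1) := by
    exact_mod_cast h1
  rw [show levelCount n (m + 1) = 2 ^ (m + 1) * (n - 1).choose m from rfl, Nat.add_sub_cancel]
  push_cast
  rw [mul_pow]
  linear_combination (-(2 : ℝ) ^ (m + 1) * κ ^ (m + 1) * (n - 1).choose m) * h2

lemma bdUp_two_mul (d n : ℕ) (κ : ℝ) : bdUp (2 * κ) d n = pEqual d n κ := by
  rw [bdUp, pEqual, bdBirth, bdDeath]
  congr 1 <;> ring

lemma levelCount_one_pos (n : ℕ) : (0 : ℝ) < levelCount n 1 := by simp [levelCount_one]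

/-- The quotient that determines `pEqual`. -/
def levelRatio {ι : Type*} (n : ℕ) (k : ι → ℝ) (t : Finset ι) : ℝ :=
  subsetSum (fun m => (levelCount n m : ℝ)) k t 0 / subsetSum (fun m => (levelCount n m : ℝ)) k t 1

lemma pEqual_eq {ι : Type*} {t : Finset ι} {d : ℕ} (ht : t.card + 1 = d) (n : ℕ)
    {κ : ℝ} (hκ : 0 < κ) :
    pEqual d n κ = (1 + 2 * levelRatio n (fun _ => κ) t) /
      (2 + 2 * levelRatio n (fun _ => κ) t) := by
  have hpos := subsetSum_one_pos (isLogConcave_levelCount n) (levelCount_one_pos n)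
    (k := fun _ : ι => κ) (fun _ => hκ) t
  rw [pEqual, birth_sum_eq ht, death_sum_eq ht, levelRatio]
  set A := subsetSum (fun m => (levelCount n m : ℝ)) (fun _ : ι => κ) t 0
  set B := subsetSum (fun m => (levelCount n m : ℝ)) (fun _ : ι => κ) t 1
  have hd : (0 : ℝ) < d := by rw [← ht]; positivity
  rw [← mul_div_mul_left (1 + 2 * (A / B)) (2 + 2 * (A / B)) (mul_pos (mul_pos hd hκ) hpos).ne']
  congr 1 <;> field_simp <;> ring

lemma levelRatio_nonneg {ι : Type*} {k : ι → ℝ} (hk : ∀ i, 0 < k i) (n : ℕ) (t : Finset ι) :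
    0 ≤ levelRatio n k t :=
  div_nonneg (Finset.sum_nonneg fun _ _ => mul_nonneg (Nat.cast_nonneg _)
      (Finset.prod_nonneg fun i _ => (hk i).le))
    (subsetSum_one_pos (isLogConcave_levelCount n) (levelCount_one_pos n) hk t).le

lemma frac_le_frac {r s : ℝ} (hr : 0 ≤ r) (h : r ≤ s) :
    (1 + 2 * r) / (2 + 2 * r) ≤ (1 + 2 * s) / (2 + 2 * s) := by
  rw [div_le_div_iff₀ (by linarith) (by linarith)]
  linarith

lemma pEqual_strictMonoOn {d n : ℕ} (hd : 2 ≤ d) : StrictMonoOn (pEqual d n) (Set.Ioi 0) := by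
  intro κ hκ κ' hκ' h
  -- Any index set with `d - 1` elements serves; it is nonempty because `d ≥ 2`, and strictness
  -- needs a variable to vary.
  have ht : (Finset.univ : Finset (Fin (d - 1))).card + 1 = d := by simp; omega
  have : Nonempty (Fin (d - 1)) := ⟨⟨0, by omega⟩⟩
  rw [pEqual_eq ht n hκ, pEqual_eq ht n hκ']
  have h1 := levelRatio_nonneg (fun _ : Fin (d - 1) => hκ) n Finset.univ
  have h2 : levelRatio n (fun _ : Fin (d - 1) => κ) Finset.univ <
      levelRatio n (fun _ => κ') Finset.univ :=
    subsetSum_ratio_strictMono (isLogConcave_levelCount n) (levelCount_one_pos n)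
      (by simp [levelCount_zero, levelCount_one]) (fun _ => hκ) (fun _ => h) Finset.univ_nonempty
  rw [div_lt_div_iff₀ (by linarith) (by linarith)]
  linarith

end Explicit

/-! ### Comparison of the limits with equal `k i`. -/

section Bounds

variable {d : ℕ} {β k : Fin d → ℝ}

lemma card_erase_add_one (i : Fin d) : (Finset.univ.erase i).card + 1 = d := by
  rw [Finset.card_erase_add_one (Finset.mem_univ i), Finset.card_univ, Fintype.card_fin]

lemma levelRatio_const_congr {κ : ℝ} (n : ℕ) (i l : Fin d) :
    levelRatio n (fun _ => κ) (Finset.univ.erase i) =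
      levelRatio n (fun _ => κ) (Finset.univ.erase l) := by
  simp only [levelRatio, subsetSum_const, Finset.card_erase_of_mem (Finset.mem_univ _)]

/-- Exhibits `offAxisSum / onAxisSum` as a weighted mean of the `levelRatio` over `i`, so that
common bounds on these ratios pass to the limit. -/
lemma offAxisSum_eq (hk : ∀ i, 0 < k i) (n : ℕ) : offAxisSum β k n =
    ∑ i, levelRatio n k (Finset.univ.erase i) *
      (β i * subsetSum (fun m => (levelCount n m : ℝ)) k (Finset.univ.erase i) 1) :=
  Finset.sum_congr rfl fun i _ => by
    have := (subsetSum_one_pos (isLogConcave_levelCount n) (levelCount_one_pos n) hk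
      (Finset.univ.erase i)).ne'
    rw [levelRatio]
    field_simp

variable [NeZero d]

lemma onAxisSum_pos (hβ : ∀ i, 0 < β i) (hk : ∀ i, 0 < k i) (n : ℕ) : 0 < onAxisSum β k n :=
  Finset.sum_pos (fun i _ => mul_pos (hβ i)
    (subsetSum_one_pos (isLogConcave_levelCount n) (levelCount_one_pos n) hk _)) ⟨0, Finset.mem_univ _⟩

/-- The limiting up-probabilities of the walk with rates `rate β k`. -/
def limitUp (β k : Fin d → ℝ) (n : ℕ) : ℝ :=
  (∑ x ∈ sphere d n, weight k x * upRate β k x) / ∑ x ∈ sphere d n, weight k x * exitRate β k x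

lemma limitUp_eq (hβ : ∀ i, 0 < β i) (hk : ∀ i, 0 < k i) {n : ℕ} (hn : 1 ≤ n) :
    limitUp β k n = (1 + 2 * (offAxisSum β k n / onAxisSum β k n)) /
      (2 + 2 * (offAxisSum β k n / onAxisSum β k n)) := by
  have := onAxisSum_pos hβ hk n
  rw [limitUp, sum_sphere_upRate hk hn, sum_sphere_exitRate hk hn,
    ← mul_div_mul_left _ (2 + _) this.ne']
  congr 1 <;> field_simp

lemma pEqual_le_limitUp (hβ : ∀ i, 0 < β i) (hk : ∀ i, 0 < k i) {n : ℕ} (hn : 1 ≤ n) {κ : ℝ}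
    (hκ : 0 < κ) (h : ∀ i, κ ≤ k i) : pEqual d n κ ≤ limitUp β k n := by
  rw [limitUp_eq hβ hk hn, pEqual_eq (card_erase_add_one (0 : Fin d)) n hκ]
  refine frac_le_frac (levelRatio_nonneg (fun _ => hκ) _ _) ?_
  rw [le_div_iff₀ (onAxisSum_pos hβ hk n), offAxisSum_eq hk, onAxisSum, Finset.mul_sum]
  refine Finset.sum_le_sum fun i _ => mul_le_mul_of_nonneg_right ?_ ?_
  · rw [levelRatio_const_congr n 0 i]
    exact subsetSum_ratio_mono (isLogConcave_levelCount n) (levelCount_one_pos n) (fun _ => hκ) h _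
  · exact (mul_pos (hβ i) (subsetSum_one_pos (isLogConcave_levelCount n) (levelCount_one_pos n) hk
      _)).le

lemma limitUp_le_pEqual (hβ : ∀ i, 0 < β i) (hk : ∀ i, 0 < k i) {n : ℕ} (hn : 1 ≤ n) {κ : ℝ}
    (h : ∀ i, k i ≤ κ) : limitUp β k n ≤ pEqual d n κ := by
  have hκ : 0 < κ := (hk 0).trans_le (h 0)
  rw [limitUp_eq hβ hk hn, pEqual_eq (card_erase_add_one (0 : Fin d)) n hκ]
  refine frac_le_frac (div_nonneg ?_ (onAxisSum_pos hβ hk n).le) ?_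
  · rw [offAxisSum_eq hk]
    exact Finset.sum_nonneg fun i _ => mul_nonneg (levelRatio_nonneg hk _ _) (mul_pos (hβ i)
      (subsetSum_one_pos (isLogConcave_levelCount n) (levelCount_one_pos n) hk _)).le
  rw [div_le_iff₀ (onAxisSum_pos hβ hk n), offAxisSum_eq hk, onAxisSum, Finset.mul_sum]
  refine Finset.sum_le_sum fun i _ => mul_le_mul_of_nonneg_right ?_ ?_
  · rw [levelRatio_const_congr n 0 i]
    exact subsetSum_ratio_mono (isLogConcave_levelCount n) (levelCount_one_pos n) hk h _
  · exact (mul_pos (hβ i) (subsetSum_one_pos (isLogConcave_levelCount n) (levelCount_one_pos n) hk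
      _)).le

/-- At the origin every jump raises the norm. -/
lemma limitUp_zero (hβ : ∀ i, 0 < β i) (hk : ∀ i, 0 < k i) : limitUp β k 0 = 1 := by
  have h0 : ∀ x ∈ sphere d 0, ∀ i, x i = 0 := fun x hx i => by
    have := (Finset.sum_eq_zero_iff.1 (mem_sphere.1 hx)) i (Finset.mem_univ i)
    simpa using this
  have h1 : ∑ x ∈ sphere d 0, weight k x * upRate β k x =
      ∑ x ∈ sphere d 0, weight k x * exitRate β k x :=
    Finset.sum_congr rfl fun x hx => by
      rw [upRate_eq, exitRate]
      congr 1
      rw [Finset.mul_sum]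
      exact Finset.sum_congr rfl fun i _ => by rw [if_pos (h0 x hx i), mul_comm]
  rw [limitUp, h1, div_self]
  obtain ⟨x, hx⟩ := exists_mem_sphere (d := d) 0
  exact (Finset.sum_pos (fun x _ => weight_mul_exitRate_pos hβ hk x) ⟨x, hx⟩).ne'

end Bounds

/-! ### The two models as instances of the common walk. -/

section Models

variable {d : ℕ}

lemma Params.α_pos (a : Params d) (i : Fin d) : 0 < a.α i := by
  linarith [a.half_δ_lt i, a.δ_nonneg i]

lemma Params.two_mul_sub_pos (a : Params d) (i : Fin d) : 0 < 2 * a.α i - a.δ i := by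
  linarith [a.half_δ_lt i]

lemma k2_ge_one (a : Params d) (i : Fin d) : 1 ≤ k2 a i :=
  (one_le_div (a.two_mul_sub_pos i)).2 (by linarith [a.δ_nonneg i])

lemma k3_pos (a : Params d) (i : Fin d) : 0 < k3 a i :=
  div_pos (a.two_mul_sub_pos i) (mul_pos two_pos (a.α_pos i))

lemma k3_le_one (a : Params d) (i : Fin d) : k3 a i ≤ 1 :=
  (div_le_one (mul_pos two_pos (a.α_pos i))).2 (by linarith [a.δ_nonneg i])

lemma rate2_eq (a : Params d) : rate2 a = rate a.α (k2 a) := by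
  funext x i
  have h1 := (a.two_mul_sub_pos i).ne'
  have h2 := (a.α_pos i).ne'
  rw [rate2, rate, k2]
  split_ifs
  · rfl
  · field_simp

lemma rate3_eq (a : Params d) : rate3 a = rate (fun i => a.α i - a.δ i / 2) (k3 a) := by
  funext x i
  have h1 := (a.two_mul_sub_pos i).ne'
  have h2 := (a.α_pos i).ne'
  rw [rate3, rate, k3]
  split_ifs
  · rfl
  · rw [eq_div_iff (div_ne_zero h1 (mul_ne_zero two_ne_zero h2)), ← mul_div_assoc,
      div_eq_iff (mul_ne_zero two_ne_zero h2)]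
    ring

lemma exitRate_le_one_of_le (a : Params d) {β k : Fin d → ℝ}
    (h : ∀ x i, rate β k x i ≤ a.α i) (x : Fin d → ℤ) : exitRate β k x ≤ 1 := by
  rw [exitRate, ← a.sum_α]
  exact mul_le_mul_of_nonneg_left (Finset.sum_le_sum fun i _ => h x i) two_pos.le

/-- The symmetric random walk. -/
def symmetricParams (d : ℕ) [NeZero d] : Params d where
  α _ := 1 / (2 * d)
  δ _ := 0
  sum_α := by
    have : (d : ℝ) ≠ 0 := Nat.cast_ne_zero.2 (NeZero.ne d)
    rw [Finset.sum_const, Finset.card_univ, Fintype.card_fin, nsmul_eq_mul]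
    field_simp
  δ_nonneg _ := le_rfl
  half_δ_lt _ := by
    have : 0 < (d : ℝ) := Nat.cast_pos.2 (Nat.pos_of_ne_zero (NeZero.ne d))
    simpa using this

variable [NeZero d]

lemma k2_symmetricParams (i : Fin d) : k2 (symmetricParams d) i = 1 := by
  have := (symmetricParams d).two_mul_sub_pos i
  have h : (symmetricParams d).δ i = 0 := rfl
  rw [h, sub_zero] at this
  rw [k2, h, sub_zero, div_self this.ne']

lemma k3_symmetricParams (i : Fin d) : k3 (symmetricParams d) i = 1 := by
  have := (symmetricParams d).two_mul_sub_pos i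
  have h : (symmetricParams d).δ i = 0 := rfl
  rw [h, sub_zero] at this
  rw [k3, h, sub_zero, div_self this.ne']

lemma boundedByBD_of_isWalk {A : Type*} {Ω : A → Type*} [∀ a, MeasurableSpace (Ω a)]
    {P : ∀ a, Measure (Ω a)} [∀ a, IsProbabilityMeasure (P a)] {S : ∀ a, ℕ → Ω a → Fin d → ℤ}
    {β k : A → Fin d → ℝ} (hβ : ∀ a i, 0 < β a i) (hk : ∀ a i, 0 < k a i)
    (hR : ∀ a x, exitRate (β a) (k a) x ≤ 1) (hS : ∀ a, IsWalk (rate (β a) (k a)) (P a) (S a)) :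
    BoundedByBD k P S := by
  intro a n hn
  refine ⟨limitUp (β a) (k a) n, (hS a).hasLimitingUpProb (hβ a) (hk a) (hR a) n, ?_, ?_,
    fun κ hκ => ?_⟩
  · rw [bdUp_two_mul]
    obtain ⟨i, hi⟩ := exists_eq_ciInf_of_finite (f := k a)
    exact pEqual_le_limitUp (hβ a) (hk a) hn (hi ▸ hk a i) fun i =>
      ciInf_le (Set.finite_range _).bddBelow i
  · rw [bdUp_two_mul]
    exact limitUp_le_pEqual (hβ a) (hk a) hn fun i => le_ciSup (Set.finite_range _).bddAbove i
  -- For equal `k i` the lower and upper bounds coincide.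
  · exact le_antisymm (limitUp_le_pEqual (hβ a) (hk a) hn fun i => (hκ i).le)
      (pEqual_le_limitUp (hβ a) (hk a) hn (hκ 0 ▸ hk a 0) fun i => (hκ i).ge)

/-- The extreme member is the symmetric walk, where all `k i = 1`: it is minimal if all `k i ≥ 1`
and maximal if all `k i ≤ 1`. -/
lemma isSemiconservative_of_isWalk {Ω : Params d → Type*} [∀ a, MeasurableSpace (Ω a)]
    {P : ∀ a, Measure (Ω a)} [∀ a, IsProbabilityMeasure (P a)] {S : ∀ a, ℕ → Ω a → Fin d → ℤ}
    {β k : Params d → Fin d → ℝ} (hβ : ∀ a i, 0 < β a i) (hk : ∀ a i, 0 < k a i)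
    (hR : ∀ a x, exitRate (β a) (k a) x ≤ 1) (hS : ∀ a, IsWalk (rate (β a) (k a)) (P a) (S a))
    (h1 : ∀ i, k (symmetricParams d) i = 1)
    (h : (∀ a i, 1 ≤ k a i) ∨ ∀ a i, k a i ≤ 1) :
    IsSemiconservative P S := by
  refine ⟨fun a => limitUp (β a) (k a), fun a n =>
    (hS a).hasLimitingUpProb (hβ a) (hk a) (hR a) n, symmetricParams d, h.imp ?_ ?_⟩
  · intro h a n
    rcases Nat.eq_zero_or_pos n with rfl | hn
    · simp only [limitUp_zero (hβ _) (hk _), le_refl]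
    · exact (limitUp_le_pEqual (hβ _) (hk _) hn fun i => (h1 i).le).trans
        (pEqual_le_limitUp (hβ _) (hk _) hn one_pos (h a))
  · intro h a n
    rcases Nat.eq_zero_or_pos n with rfl | hn
    · simp only [limitUp_zero (hβ _) (hk _), le_refl]
    · exact (limitUp_le_pEqual (hβ _) (hk _) hn (h a)).trans
        (pEqual_le_limitUp (hβ _) (hk _) hn one_pos fun i => (h1 i).ge)

end Models

end SemiWalk

end

theorem theorem2 (d : ℕ) (hd : 1 ≤ d) :
    (∀ (Ω : SemiWalk.Params d → Type*) [∀ a, MeasurableSpace (Ω a)]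
        (P : ∀ a, Measure (Ω a)) [∀ a, IsProbabilityMeasure (P a)]
        (S : ∀ a, ℕ → Ω a → Fin d → ℤ),
        (∀ a, SemiWalk.IsWalk (SemiWalk.rate2 a) (P a) (S a)) →
          SemiWalk.IsSemiconservative P S ∧ SemiWalk.BoundedByBD SemiWalk.k2 P S) ∧
    (∀ (Ω : SemiWalk.Params d → Type*) [∀ a, MeasurableSpace (Ω a)]
        (P : ∀ a, Measure (Ω a)) [∀ a, IsProbabilityMeasure (P a)]
        (S : ∀ a, ℕ → Ω a → Fin d → ℤ),
        (∀ a, SemiWalk.IsWalk (SemiWalk.rate3 a) (P a) (S a)) →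
          SemiWalk.IsSemiconservative P S ∧ SemiWalk.BoundedByBD SemiWalk.k3 P S) ∧
    (2 ≤ d → ∀ n : ℕ, 1 ≤ n → StrictMonoOn (SemiWalk.pEqual d n) (Set.Ioi 0)) := by
  have : NeZero d := ⟨by omega⟩
  refine ⟨fun Ω _ P _ S hS => ?_, fun Ω _ P _ S hS => ?_, fun h2 n _ =>
    SemiWalk.pEqual_strictMonoOn h2⟩
  · have hβ : ∀ (a : SemiWalk.Params d) i, 0 < a.α i := SemiWalk.Params.α_pos
    have hk : ∀ (a : SemiWalk.Params d) i, 0 < SemiWalk.k2 a i := fun a i =>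
      one_pos.trans_le (SemiWalk.k2_ge_one a i)
    simp_rw [SemiWalk.rate2_eq] at hS
    have hR : ∀ (a : SemiWalk.Params d) x, SemiWalk.exitRate a.α (SemiWalk.k2 a) x ≤ 1 := fun a =>
      SemiWalk.exitRate_le_one_of_le a fun x i => by
        rw [← SemiWalk.rate2_eq, SemiWalk.rate2]
        split_ifs <;> linarith [a.δ_nonneg i]
    exact ⟨SemiWalk.isSemiconservative_of_isWalk hβ hk hR hS SemiWalk.k2_symmetricParams
      (Or.inl SemiWalk.k2_ge_one), SemiWalk.boundedByBD_of_isWalk hβ hk hR hS⟩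
  · simp_rw [SemiWalk.rate3_eq] at hS
    have hR : ∀ (a : SemiWalk.Params d) x,
        SemiWalk.exitRate (fun i => a.α i - a.δ i / 2) (SemiWalk.k3 a) x ≤ 1 := fun a =>
      SemiWalk.exitRate_le_one_of_le a fun x i => by
        rw [← SemiWalk.rate3_eq, SemiWalk.rate3]
        split_ifs <;> linarith [a.δ_nonneg i]
    exact ⟨SemiWalk.isSemiconservative_of_isWalk SemiWalk.Params.half_δ_lt SemiWalk.k3_pos hR hS
      SemiWalk.k3_symmetricParams (Or.inr SemiWalk.k3_le_one),
      SemiWalk.boundedByBD_of_isWalk SemiWalk.Params.half_δ_lt SemiWalk.k3_pos hR hS⟩
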